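/- Let $(G_\sigma)_{\sigma\ge 1}$ be a log-convolution semigroup: each $G_\sigma$ is a probability measure on $[0,1]$, and for all $\sigma,\tau\ge1$ the product of two independent random variables with laws $G_\sigma$ and $G_\tau$ has law $G_{\sigma\tau}$. Let $\psi(\lambda)=-\ln\int r^\lambda\,G_e(dr)$, $\lambda>0$, be its Laplace exponent (so that $\int r^\lambda\,G_\sigma(dr)=\sigma^{-\psi(\lambda)}$ for all $\sigma\ge1$), and assume $\psi(1/2)=1$. Put $\delta=\psi(1)/2$. For $t>0$ let $P_{0,t}(x,\cdot)$ be the Gaussian law with mean $x$ and variance $t$; for $0<s<t$, with $\sigma=\sqrt{t/s}$, let $P_{s,t}(x,\cdot)$ be the law of $\sigma\bigl(\sqrt{R}\,x+\sqrt{s}\sqrt{1-R}\,\xi\bigr)$, where $R$ has law $G_\sigma$ and $\xi$ is standard Gaussian and independent of $R$. On a probability space with a filtration $(\mathcal F_t)_{t\ge0}$, let $(X_t)_{t\ge0}$ be a real, progressively measurable process with $X_0=0$ almost surely which is Markov relative to $(\mathcal F_t)$ with transition probabilities $P_{s,t}$, that is, $\mathbb P[X_t\in B\mid\mathcal F_s]=P_{s,t}(X_s,B)$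 almost surely for all $s<t$ and all Borel sets $B$. Then $X$ is a square integrable $(\mathcal F_t)$-martingale, almost surely $\int_0^t X_s^2/s\,ds<\infty$ for all $t\ge 0$, and the predictable quadratic variation of $X$ is $$\langle X,X\rangle_t=\delta t+(1-\delta)\int_0^t\frac{X_s^2}{s}\,ds ;$$ that is, the right-hand side is a predictable process, null at $0$, with almost surely nondecreasing right-continuous paths, and $X_t^2-\delta t-(1-\delta)\int_0^t\frac{X_s^2}{s}\,ds$ is an $(\mathcal F_t)$-martingale. Furthermore, for every $t\ge0$ and every sequence of subdivisions $0=t_0<t_1<\dots<t_n=t$ of $[0,t]$ whose mesh $\max_k(t_{k+1}-t_k)$ tends to $0$, $$\sum_{k=0}^{n-1}\mathbb E\bigl[(X_{t_{k+1}}-X_{t_k})^2\mid X_{t_k}\bigr]\longrightarrow\langle X,X\rangle_t\quad\text{in probability.}$$ -/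

import Mathlib

open MeasureTheory ProbabilityTheory Filter Topology
open scoped NNReal ENNReal

noncomputable section

/-- `(G σ)`, `σ ≥ 1`, is a log-convolution semigroup of probability measures on `[0, 1]`: the
product of two independent random variables with laws `G σ` and `G τ` has law `G (σ * τ)`. -/
structure IsLogConvolutionSemigroup (G : ℝ → Measure ℝ) : Prop where
  isProbabilityMeasure : ∀ σ, 1 ≤ σ → IsProbabilityMeasure (G σ)
  mem_unitInterval : ∀ σ, 1 ≤ σ → ∀ᵐ r ∂(G σ), r ∈ Set.Icc (0 : ℝ) 1
  mconv_eq : ∀ σ τ, 1 ≤ σ → 1 ≤ τ → Measure.mconv (G σ) (G τ) = G (σ * τ)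

/-- `L_σ(p) = E[R_σ ^ p]`, where `R_σ` has law `G σ`; that is, the Laplace transform
`E[exp (-p U_σ)]` of `U_σ = -ln R_σ`. -/
def laplaceTransform (G : ℝ → Measure ℝ) (σ p : ℝ) : ℝ :=
  ∫ r, r ^ p ∂(G σ)

/-- The Laplace exponent of a log-convolution semigroup: `ln L_σ(p) = -ψ(p) ln σ`, read at
`σ = e`. -/
def laplaceExponent (G : ℝ → Measure ℝ) (p : ℝ) : ℝ :=
  -Real.log (laplaceTransform G (Real.exp 1) p)

/-- If `ln L_σ` has the Lévy-Khinchin form with drift `β` and Lévy measure `ν`, then the Laplace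
exponent is the usual expression in `β` and `ν`. -/
lemma laplaceExponent_eq_of_levyKhinchin (G : ℝ → Measure ℝ) (β : ℝ) (ν : Measure ℝ) (p : ℝ)
    (h : ∀ σ, 1 ≤ σ → Real.log (laplaceTransform G σ p) =
      -(β * p + ∫ x in Set.Ioi 0, (1 - Real.exp (-p * x)) ∂ν) * Real.log σ) :
    laplaceExponent G p = β * p + ∫ x in Set.Ioi 0, (1 - Real.exp (-p * x)) ∂ν := by
  rw [laplaceExponent, h _ (Real.one_le_exp zero_le_one), Real.log_exp]
  ring

/-- The transition probabilities `P_{s,t}(x, dy)`, for `s < t`. For `s = 0` this is the Gaussian law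
with mean `x` and variance `t`; for `s > 0` it is the law of
`σ (√R x + √s √(1 - R) ξ)`, where `σ = √(t / s)`, `R` has law `G σ` and `ξ` is an independent
standard Gaussian variable. -/
def transitionLaw (G : ℝ → Measure ℝ) (s t : ℝ≥0) (x : ℝ) : Measure ℝ :=
  if s = 0 then gaussianReal x t
  else ((G (√((t : ℝ) / s))).prod (gaussianReal 0 1)).map fun q : ℝ × ℝ =>
    √((t : ℝ) / s) * (√q.1 * x + √(s : ℝ) * √(1 - q.1) * q.2)

/-- `X` starts at zero and is a Markov process, relative to the filtration `ℱ`, with the transition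
probabilities `transitionLaw G`. Progressive measurability (which every adapted right-continuous
process has) is what gives a meaning to time integrals of `X` as adapted processes. -/
structure IsMarkovProcessOf {Ω : Type*} {mΩ : MeasurableSpace Ω} (G : ℝ → Measure ℝ)
    (X : ℝ≥0 → Ω → ℝ) (ℱ : Filtration ℝ≥0 mΩ) (μ : Measure Ω) : Prop where
  isProgressive : IsProgressive ℱ X
  start : ∀ᵐ ω ∂μ, X 0 ω = 0
  markov : ∀ s t : ℝ≥0, s < t → ∀ B : Set ℝ, MeasurableSet B →
    μ[(X t ⁻¹' B).indicator (fun _ => (1 : ℝ)) | ℱ s]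
      =ᵐ[μ] fun ω => (transitionLaw G s t (X s ω)).real B

/-- `A` is (a version of) the predictable quadratic variation `⟨X, X⟩` of the square integrable
martingale `X`: it is a predictable process, null at zero, with almost surely nondecreasing and
right-continuous paths, such that `X² - A` is a martingale. -/
structure IsPredictableQuadraticVariation {Ω : Type*} {mΩ : MeasurableSpace Ω}
    (X A : ℝ≥0 → Ω → ℝ) (ℱ : Filtration ℝ≥0 mΩ) (μ : Measure Ω) : Prop where
  martingale : Martingale X ℱ μ
  memLp_two : ∀ t, MemLp (X t) 2 μ
  predictable : IsStronglyPredictable ℱ A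
  zero : ∀ᵐ ω ∂μ, A 0 ω = 0
  monotone : ∀ᵐ ω ∂μ, Monotone fun t => A t ω
  rightContinuous : ∀ᵐ ω ∂μ, ∀ t, ContinuousWithinAt (fun u => A u ω) (Set.Ici t) t
  sq_sub_martingale : Martingale (fun t ω => X t ω ^ 2 - A t ω) ℱ μ

/-- A subdivision `0 = t_0 < t_1 < ... < t_n = t` of `[0, t]`. -/
structure Subdivision (t : ℝ≥0) where
  n : ℕ
  pt : Fin (n + 1) → ℝ≥0
  strictMono : StrictMono pt
  first : pt 0 = 0
  last : pt (Fin.last n) = t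

/-- The largest length of an interval of the subdivision. -/
def Subdivision.mesh {t : ℝ≥0} (π : Subdivision t) : ℝ≥0 :=
  Finset.univ.sup fun k : Fin π.n => π.pt k.succ - π.pt k.castSucc

/-- `∑_{k < n} E[(X_{t_{k+1}} - X_{t_k})² | X_{t_k}]`. -/
def Subdivision.condSqSum {Ω : Type*} {mΩ : MeasurableSpace Ω} {t : ℝ≥0} (π : Subdivision t)
    (X : ℝ≥0 → Ω → ℝ) (μ : Measure Ω) (ω : Ω) : ℝ :=
  ∑ k : Fin π.n,
    (μ[fun ω' => (X (π.pt k.succ) ω' - X (π.pt k.castSucc) ω') ^ 2 |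
      MeasurableSpace.comap (X (π.pt k.castSucc)) inferInstance]) ω

/-- The process `δ t + (1 - δ) ∫_0^t X_s² / s ds`. -/
def quadVarFormula {Ω : Type*} (δ : ℝ) (X : ℝ≥0 → Ω → ℝ) (t : ℝ≥0) (ω : Ω) : ℝ :=
  δ * t + (1 - δ) * ∫ s in (0 : ℝ)..t, X s.toNNReal ω ^ 2 / s

end

/-! ### Power law of the moments of a log-convolution semigroup. -/

section Semigroup

variable {G : ℝ → Measure ℝ}

/-! Everything rests on two moments of `R`. The normalisation ψ(1/2) = 1 gives E[√R] = 1/σ, which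
makes `X` a martingale, and E[R] = σ^(-ψ(1)) turns Y_t = X_t² - t into a process with E[Y_t | ℱ_s] =
(t/s)^(1-δ) Y_s (`IsMarkovProcessOf.condExp_sq_sub`). As u ↦ (u/s)^(1-δ) solves f' = (1-δ) f/u with
f(s) = 1, the process Y_t - (1-δ) ∫_0^t Y_u/u du is a martingale
(`IsMarkovProcessOf.setIntegral_compensator`). Since Y_u/u = X_u²/u - 1, it equals X_t² minus the
claimed bracket. The marginals N(0, t), read off from the transition out of time 0, give E[X_u²/u] =
1 and hence finiteness of the time integral.

Monotonicity of the bracket needs 0 ≤ δ ≤ 1, which comes from E[√R]² ≤ E[R] ≤ 1. Predictability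
comes from left-continuity of the time integral taken in [0, ∞], valid on every path.

For the subdivisions, the conditional variance over [s, t] minus the increment of the bracket is
(1-δ) ∫_s^t (E[Y_u | ℱ_s] - Y_u)/u du. By Gaussian scaling E[Y_u²] = K u², so the L² norm of the
numerator is at most √(2K u (u-s)) (`IsMarkovProcessOf.integral_abs_sq_sub_le`). Integrating against
du/u bounds the L¹ error by 2 √(2K·mesh) (√t - √s), which telescopes to O(√mesh) over the whole
subdivision. -/

lemma IsLogConvolutionSemigroup.rpow_mem_unitInterval (hG : IsLogConvolutionSemigroup G)
    {σ p : ℝ} (hσ : 1 ≤ σ) (hp : 0 ≤ p) : ∀ᵐ r ∂(G σ), r ^ p ∈ Set.Icc (0 : ℝ) 1 := by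
  filter_upwards [hG.mem_unitInterval σ hσ] with r hr
  exact ⟨Real.rpow_nonneg hr.1 p, Real.rpow_le_one hr.1 hr.2 hp⟩

lemma IsLogConvolutionSemigroup.integrable_rpow (hG : IsLogConvolutionSemigroup G)
    {σ p : ℝ} (hσ : 1 ≤ σ) (hp : 0 ≤ p) : Integrable (fun r : ℝ => r ^ p) (G σ) := by
  have := hG.isProbabilityMeasure σ hσ
  refine Integrable.of_bound (C := 1) (by fun_prop) ?_
  filter_upwards [hG.rpow_mem_unitInterval hσ hp] with r hr
  rw [Real.norm_of_nonneg hr.1]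
  exact hr.2

lemma IsLogConvolutionSemigroup.laplaceTransform_nonneg (hG : IsLogConvolutionSemigroup G)
    {σ p : ℝ} (hσ : 1 ≤ σ) (hp : 0 ≤ p) : 0 ≤ laplaceTransform G σ p :=
  integral_nonneg_of_ae ((hG.rpow_mem_unitInterval hσ hp).mono fun _ h => h.1)

lemma IsLogConvolutionSemigroup.laplaceTransform_le_one (hG : IsLogConvolutionSemigroup G)
    {σ p : ℝ} (hσ : 1 ≤ σ) (hp : 0 ≤ p) : laplaceTransform G σ p ≤ 1 := by
  have := hG.isProbabilityMeasure σ hσ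
  calc laplaceTransform G σ p ≤ ∫ _, (1 : ℝ) ∂(G σ) :=
        integral_mono_ae (hG.integrable_rpow hσ hp) (integrable_const _)
          ((hG.rpow_mem_unitInterval hσ hp).mono fun _ h => h.2)
    _ = 1 := by simp

lemma IsLogConvolutionSemigroup.laplaceTransform_mul (hG : IsLogConvolutionSemigroup G)
    {σ τ p : ℝ} (hσ : 1 ≤ σ) (hτ : 1 ≤ τ) :
    laplaceTransform G (σ * τ) p = laplaceTransform G σ p * laplaceTransform G τ p := by
  have := hG.isProbabilityMeasure σ hσ
  have := hG.isProbabilityMeasure τ hτ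
  rw [laplaceTransform, ← hG.mconv_eq σ τ hσ hτ, Measure.mconv,
    integral_map (by fun_prop) (by fun_prop), laplaceTransform, laplaceTransform,
    ← integral_prod_mul]
  have h1 : ∀ᵐ z ∂((G σ).prod (G τ)), 0 ≤ z.1 :=
    Measure.quasiMeasurePreserving_fst.ae ((hG.mem_unitInterval σ hσ).mono fun _ h => h.1)
  have h2 : ∀ᵐ z ∂((G σ).prod (G τ)), 0 ≤ z.2 :=
    Measure.quasiMeasurePreserving_snd.ae ((hG.mem_unitInterval τ hτ).mono fun _ h => h.1)
  refine integral_congr_ae ?_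
  filter_upwards [h1, h2] with z hz1 hz2
  exact Real.mul_rpow hz1 hz2

/-- A multiplicative map of `[1, ∞)` into `[0, 1]` which does not vanish at `e` is a power. -/
lemma eq_rpow_of_mul_of_mem_unitInterval {f : ℝ → ℝ}
    (hmul : ∀ σ τ, 1 ≤ σ → 1 ≤ τ → f (σ * τ) = f σ * f τ)
    (h0 : ∀ σ, 1 ≤ σ → 0 ≤ f σ) (h1 : ∀ σ, 1 ≤ σ → f σ ≤ 1) (he : 0 < f (Real.exp 1))
    {σ : ℝ} (hσ : 1 ≤ σ) : f σ = σ ^ Real.log (f (Real.exp 1)) := by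
  have hpow : ∀ (n : ℕ) (x : ℝ), 1 ≤ x → f (x ^ (n + 1)) = f x ^ (n + 1) := by
    intro n x hx
    induction n with
    | zero => simp
    | succ n ih => rw [pow_succ, hmul _ _ (one_le_pow₀ hx) hx, ih, ← pow_succ]
  have hanti : ∀ x y, 1 ≤ x → x ≤ y → f y ≤ f x := by
    intro x y hx hxy
    have hx0 : 0 < x := by linarith
    have hyx : 1 ≤ y / x := (one_le_div hx0).2 hxy
    have := hmul x (y / x) hx hyx
    rw [mul_div_cancel₀ _ hx0.ne'] at this
    rw [this]
    exact mul_le_of_le_one_right (h0 x hx) (h1 _ hyx)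
  have he1 : 1 ≤ Real.exp 1 := Real.one_le_exp zero_le_one
  have hpos : ∀ x, 1 ≤ x → 0 < f x := by
    intro x hx
    obtain ⟨n, hn⟩ := exists_nat_ge (Real.log x)
    have : x ≤ Real.exp 1 ^ (n + 1) := by
      rw [← Real.exp_nat_mul, ← Real.log_le_iff_le_exp (by linarith)]
      push_cast; linarith
    exact (hpow n _ he1 ▸ pow_pos he (n + 1)).trans_le (hanti _ _ hx this)
  set c := Real.log (f (Real.exp 1)) with hc
  have hc0 : c ≤ 0 := Real.log_nonpos he.le (h1 _ he1)
  have hx0 : 0 ≤ Real.log σ := Real.log_nonneg hσ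
  have hσ0 : 0 < σ := by linarith
  have key : ∀ n : ℕ, |((n : ℝ) + 1) * (Real.log (f σ) - c * Real.log σ)| ≤ -2 * c := by
    intro n
    set m := ⌊((n : ℝ) + 1) * Real.log σ⌋₊ with hm
    have hm1 : (m : ℝ) ≤ ((n : ℝ) + 1) * Real.log σ := Nat.floor_le (by positivity)
    have hm2 : ((n : ℝ) + 1) * Real.log σ < m + 1 := Nat.lt_floor_add_one _
    have hlog : Real.log (f (σ ^ (n + 1))) = ((n : ℝ) + 1) * Real.log (f σ) := by
      rw [hpow n σ hσ, Real.log_pow]; push_cast; ring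
    have hup : Real.log (f (σ ^ (n + 1))) ≥ c * (m + 1) := by
      have : σ ^ (n + 1) ≤ Real.exp 1 ^ (m + 1) := by
        rw [← Real.exp_nat_mul, ← Real.log_le_iff_le_exp (by positivity), Real.log_pow]
        push_cast; linarith
      have := Real.log_le_log (hpos _ (one_le_pow₀ he1)) (hanti _ _ (one_le_pow₀ hσ) this)
      rw [hpow m _ he1, Real.log_pow, ← hc] at this
      push_cast at this; linarith
    have hlo : Real.log (f (σ ^ (n + 1))) ≤ c * (m - 1) := by
      -- For m = 0 the bound is -c ≥ 0, so f ≤ 1 suffices; otherwise e^m ≤ σ^(n+1) gives even c * m.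
      rcases Nat.eq_zero_or_pos m with h | h
      · have := Real.log_nonpos (hpos _ (one_le_pow₀ hσ)).le (h1 (σ ^ (n + 1)) (one_le_pow₀ hσ))
        rw [h]; push_cast; linarith
      · obtain ⟨k, hk⟩ := Nat.exists_eq_add_of_lt h
        have hk' : m = k + 1 := by omega
        have : Real.exp 1 ^ (k + 1) ≤ σ ^ (n + 1) := by
          rw [← Real.exp_nat_mul, ← Real.le_log_iff_exp_le (by positivity), Real.log_pow]
          rw [hk'] at hm1
          push_cast at hm1 ⊢; linarith
        have := Real.log_le_log (hpos _ (one_le_pow₀ hσ)) (hanti _ _ (one_le_pow₀ he1) this)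
        rw [hpow k _ he1, Real.log_pow, ← hc, ← hk'] at this
        linarith
    rw [hlog] at hup hlo
    rw [abs_le]
    constructor <;> nlinarith
  have hz : Real.log (f σ) - c * Real.log σ = 0 := by
    by_contra hne
    have hpos' : 0 < |Real.log (f σ) - c * Real.log σ| := abs_pos.2 hne
    obtain ⟨n, hn⟩ := exists_nat_gt (-2 * c / |Real.log (f σ) - c * Real.log σ|)
    rw [div_lt_iff₀ hpos'] at hn
    have := key n
    rw [abs_mul, abs_of_nonneg (by positivity : (0 : ℝ) ≤ (n : ℝ) + 1)] at this
    nlinarith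
  rw [Real.rpow_def_of_pos hσ0, mul_comm (Real.log σ), ← sub_eq_zero.1 hz,
    Real.exp_log (hpos σ hσ)]

lemma IsLogConvolutionSemigroup.laplaceTransform_eq_rpow (hG : IsLogConvolutionSemigroup G)
    {σ p : ℝ} (hσ : 1 ≤ σ) (hp : 0 ≤ p) (he : laplaceTransform G (Real.exp 1) p ≠ 0) :
    laplaceTransform G σ p = σ ^ (-laplaceExponent G p) := by
  rw [laplaceExponent, neg_neg]
  exact eq_rpow_of_mul_of_mem_unitInterval (f := fun σ => laplaceTransform G σ p)
    (fun σ τ hσ hτ => hG.laplaceTransform_mul hσ hτ)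
    (fun σ hσ => hG.laplaceTransform_nonneg hσ hp) (fun σ hσ => hG.laplaceTransform_le_one hσ hp)
    (lt_of_le_of_ne (hG.laplaceTransform_nonneg (Real.one_le_exp zero_le_one) hp) he.symm) hσ

/-- The variance of √R is nonnegative. This is the source of δ ≤ 1. -/
lemma IsLogConvolutionSemigroup.laplaceTransform_half_sq_le (hG : IsLogConvolutionSemigroup G)
    {σ : ℝ} (hσ : 1 ≤ σ) : laplaceTransform G σ (1 / 2) ^ 2 ≤ laplaceTransform G σ 1 := by
  have := hG.isProbabilityMeasure σ hσ
  set a := laplaceTransform G σ (1 / 2) with ha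
  have hi := hG.integrable_rpow hσ (p := 1 / 2) (by norm_num)
  have hi1 := hG.integrable_rpow hσ (p := 1) (by norm_num)
  have h : 0 ≤ ∫ r, (r ^ (1 : ℝ) - 2 * a * r ^ (1 / 2 : ℝ) + a ^ 2) ∂(G σ) := by
    refine integral_nonneg_of_ae ?_
    filter_upwards [hG.mem_unitInterval σ hσ] with r hr
    have : r ^ (1 : ℝ) = (r ^ (1 / 2 : ℝ)) ^ 2 := by
      rw [← Real.sqrt_eq_rpow, Real.sq_sqrt hr.1, Real.rpow_one]
    simp only [Pi.zero_apply]
    rw [this]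
    nlinarith [sq_nonneg (r ^ (1 / 2 : ℝ) - a)]
  have hi2 : Integrable (fun r : ℝ => r ^ (1 : ℝ) - 2 * a * r ^ (1 / 2 : ℝ)) (G σ) :=
    hi1.sub (hi.const_mul _)
  rw [integral_add hi2 (integrable_const _),
    integral_sub hi1 (hi.const_mul _), integral_const_mul] at h
  change 0 ≤ laplaceTransform G σ 1 - 2 * a * a + _ at h
  simp at h
  nlinarith

/-- A zero transform would have logarithm 0 by the default value of `Real.log`, contradicting ψ(1/2)
= 1. -/
lemma laplaceTransform_exp_half_pos (hG : IsLogConvolutionSemigroup G)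
    (hψ : laplaceExponent G (1 / 2) = 1) : 0 < laplaceTransform G (Real.exp 1) (1 / 2) := by
  refine lt_of_le_of_ne
    (hG.laplaceTransform_nonneg (Real.one_le_exp zero_le_one) (by norm_num)) fun h => ?_
  rw [laplaceExponent, ← h] at hψ
  simp at hψ

lemma laplaceTransform_exp_one_pos (hG : IsLogConvolutionSemigroup G)
    (hψ : laplaceExponent G (1 / 2) = 1) : 0 < laplaceTransform G (Real.exp 1) 1 :=
  (pow_pos (laplaceTransform_exp_half_pos hG hψ) 2).trans_le
    (hG.laplaceTransform_half_sq_le (Real.one_le_exp zero_le_one))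

lemma IsLogConvolutionSemigroup.integral_sqrt_eq (hG : IsLogConvolutionSemigroup G)
    (hψ : laplaceExponent G (1 / 2) = 1) {σ : ℝ} (hσ : 1 ≤ σ) : ∫ r, √r ∂(G σ) = σ⁻¹ := by
  have := hG.laplaceTransform_eq_rpow hσ (p := 1 / 2) (by norm_num)
    (laplaceTransform_exp_half_pos hG hψ).ne'
  rw [hψ, Real.rpow_neg_one] at this
  simpa only [laplaceTransform, ← Real.sqrt_eq_rpow] using this

lemma IsLogConvolutionSemigroup.integral_id_eq (hG : IsLogConvolutionSemigroup G)
    (hψ : laplaceExponent G (1 / 2) = 1) {σ : ℝ} (hσ : 1 ≤ σ) :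
    ∫ r, r ∂(G σ) = σ ^ (-laplaceExponent G 1) := by
  have := hG.laplaceTransform_eq_rpow hσ (p := 1) (by norm_num)
    (laplaceTransform_exp_one_pos hG hψ).ne'
  simpa only [laplaceTransform, Real.rpow_one] using this

lemma laplaceExponent_one_nonneg (hG : IsLogConvolutionSemigroup G)
    (hψ : laplaceExponent G (1 / 2) = 1) : 0 ≤ laplaceExponent G 1 := by
  have := Real.log_nonpos (laplaceTransform_exp_one_pos hG hψ).le
    (hG.laplaceTransform_le_one (Real.one_le_exp zero_le_one) zero_le_one)
  rw [laplaceExponent]; linarith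

lemma laplaceExponent_one_le_two (hG : IsLogConvolutionSemigroup G)
    (hψ : laplaceExponent G (1 / 2) = 1) : laplaceExponent G 1 ≤ 2 := by
  have := Real.log_le_log (pow_pos (laplaceTransform_exp_half_pos hG hψ) 2)
    (hG.laplaceTransform_half_sq_le (Real.one_le_exp zero_le_one))
  rw [Real.log_pow] at this
  rw [laplaceExponent] at hψ ⊢
  push_cast at this
  linarith

end Semigroup

/-! ### First and second moments of the transition law. -/

section TransitionMoments

variable {G : ℝ → Measure ℝ} {s t : ℝ≥0}

lemma one_le_sqrt_div (hs : 0 < s) (hst : s ≤ t) : 1 ≤ √((t : ℝ) / s) := by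
  rw [Real.one_le_sqrt, one_le_div (by exact_mod_cast hs)]
  exact_mod_cast hst

/-- The random variable whose law is `transitionLaw G s t x` for `s > 0`. -/
noncomputable def transitionStep (s t : ℝ≥0) (x : ℝ) (q : ℝ × ℝ) : ℝ :=
  √((t : ℝ) / s) * (√q.1 * x + √(s : ℝ) * √(1 - q.1) * q.2)

lemma measurable_transitionStep (s t : ℝ≥0) :
    Measurable fun z : ℝ × ℝ × ℝ => transitionStep s t z.1 z.2 := by
  unfold transitionStep
  fun_prop

lemma transitionLaw_of_pos (hs : 0 < s) (x : ℝ) :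
    transitionLaw G s t x =
      ((G (√((t : ℝ) / s))).prod (gaussianReal 0 1)).map (transitionStep s t x) :=
  if_neg hs.ne'

lemma integrable_of_ae_unitInterval {ν : Measure ℝ} [IsProbabilityMeasure ν]
    (hν : ∀ᵐ r ∂ν, r ∈ Set.Icc (0 : ℝ) 1) {f : ℝ → ℝ} (hf : Measurable f)
    (hf1 : ∀ r ∈ Set.Icc (0 : ℝ) 1, |f r| ≤ 1) : Integrable f ν :=
  Integrable.of_bound (C := 1) hf.aestronglyMeasurable (hν.mono fun r hr => hf1 r hr)

lemma abs_sqrt_le_one {r : ℝ} (hr : r ≤ 1) : |√r| ≤ 1 := by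
  rw [abs_of_nonneg (Real.sqrt_nonneg r)]
  exact Real.sqrt_le_one.2 hr

lemma integrable_id_gaussianReal_one : Integrable (fun z : ℝ => z) (gaussianReal 0 1) :=
  (memLp_id_gaussianReal 1).integrable (by simp)

lemma integrable_sq_gaussianReal_one : Integrable (fun z : ℝ => z ^ 2) (gaussianReal 0 1) :=
  (memLp_id_gaussianReal 2).integrable_sq

lemma integral_sq_gaussianReal_one : ∫ z, z ^ 2 ∂(gaussianReal 0 1) = 1 := by
  have h := variance_fun_id_gaussianReal (μ := 0) (v := 1)
  rw [variance_of_integral_eq_zero (by fun_prop) (by simp)] at h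
  simpa using h

/-- The noise is centred and σ E[√R] = 1. -/
lemma integral_transitionStep (hG : IsLogConvolutionSemigroup G)
    (hψ : laplaceExponent G (1 / 2) = 1) (hs : 0 < s) (hst : s ≤ t) (x : ℝ) :
    ∫ q, transitionStep s t x q ∂((G (√((t : ℝ) / s))).prod (gaussianReal 0 1)) = x := by
  have hσ := one_le_sqrt_div hs hst
  set σ := √((t : ℝ) / s) with hσdef
  have := hG.isProbabilityMeasure σ hσ
  have hν := hG.mem_unitInterval σ hσ
  have h1 : Integrable (fun r : ℝ => √r) (G σ) :=
    integrable_of_ae_unitInterval hν (by fun_prop) fun r hr => abs_sqrt_le_one hr.2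
  have h2 : Integrable (fun r : ℝ => √(1 - r)) (G σ) :=
    integrable_of_ae_unitInterval hν (by fun_prop) fun r hr => abs_sqrt_le_one (by linarith [hr.1])
  have e : ∀ q : ℝ × ℝ, transitionStep s t x q =
      σ * x * (√q.1 * 1) + σ * √(s : ℝ) * (√(1 - q.1) * q.2) := fun q => by
    rw [transitionStep]; ring
  simp_rw [e]
  rw [integral_add ((h1.mul_prod (integrable_const (1 : ℝ))).const_mul _)
      ((h2.mul_prod integrable_id_gaussianReal_one).const_mul _),
    integral_const_mul, integral_const_mul,
    integral_prod_mul (fun r : ℝ => √r) (fun _ : ℝ => (1 : ℝ)),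
    integral_prod_mul (fun r : ℝ => √(1 - r)) (fun z : ℝ => z),
    hG.integral_sqrt_eq hψ hσ]
  have : σ ≠ 0 := by linarith
  simp
  field_simp

/-- The cross term is centred, and since σ² s = t the noise contributes t (1 - E[R]). Subtracting t
leaves σ² E[R] (x² - s), with σ² E[R] = (σ²)^(1 - ψ(1)/2). -/
lemma integral_transitionStep_sq_sub (hG : IsLogConvolutionSemigroup G)
    (hψ : laplaceExponent G (1 / 2) = 1) (hs : 0 < s) (hst : s ≤ t) (x : ℝ) :
    ∫ q, (transitionStep s t x q ^ 2 - t) ∂((G (√((t : ℝ) / s))).prod (gaussianReal 0 1)) =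
      ((t : ℝ) / s) ^ (1 - laplaceExponent G 1 / 2) * (x ^ 2 - s) := by
  have hσ := one_le_sqrt_div hs hst
  set σ := √((t : ℝ) / s) with hσdef
  have := hG.isProbabilityMeasure σ hσ
  have hν := hG.mem_unitInterval σ hσ
  have hs' : (0 : ℝ) < s := by exact_mod_cast hs
  have ht' : (0 : ℝ) < t := by exact_mod_cast hs.trans_le hst
  have hσ2 : σ ^ 2 = t / s := Real.sq_sqrt (by positivity)
  have hσs : σ ^ 2 * s = t := by rw [hσ2]; field_simp
  have h1 : Integrable (fun r : ℝ => r) (G σ) :=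
    integrable_of_ae_unitInterval hν (by fun_prop) fun r hr => by
      rw [abs_of_nonneg hr.1]; exact hr.2
  have h2 : Integrable (fun r : ℝ => √r * √(1 - r)) (G σ) :=
    integrable_of_ae_unitInterval hν (by fun_prop) fun r hr => by
      rw [abs_mul]
      exact mul_le_one₀ (abs_sqrt_le_one hr.2) (abs_nonneg _)
        (abs_sqrt_le_one (by linarith [hr.1]))
  have h3 : Integrable (fun r : ℝ => 1 - r) (G σ) := (integrable_const _).sub h1
  have e : ∀ᵐ q ∂((G σ).prod (gaussianReal 0 1)), transitionStep s t x q ^ 2 - t =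
      σ ^ 2 * x ^ 2 * (q.1 * 1) + 2 * σ ^ 2 * x * √(s : ℝ) * (√q.1 * √(1 - q.1) * q.2)
        + t * ((1 - q.1) * q.2 ^ 2) - t := by
    filter_upwards [Measure.quasiMeasurePreserving_fst.ae hν] with q hq
    have a1 : √q.1 ^ 2 = q.1 := Real.sq_sqrt hq.1
    have a2 : √(1 - q.1) ^ 2 = 1 - q.1 := Real.sq_sqrt (by linarith [hq.2])
    have a3 : √(s : ℝ) ^ 2 = s := Real.sq_sqrt hs'.le
    rw [transitionStep, ← hσdef]
    calc _ = σ ^ 2 * x ^ 2 * (√q.1 ^ 2 * 1)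
          + 2 * σ ^ 2 * x * √(s : ℝ) * (√q.1 * √(1 - q.1) * q.2)
          + σ ^ 2 * √(s : ℝ) ^ 2 * (√(1 - q.1) ^ 2 * q.2 ^ 2) - t := by ring
      _ = _ := by rw [a1, a2, a3, hσs]
  rw [integral_congr_ae e]
  have i1 := (h1.mul_prod (integrable_const (μ := gaussianReal 0 1) (1 : ℝ))).const_mul
    (σ ^ 2 * x ^ 2)
  have i2 := (h2.mul_prod integrable_id_gaussianReal_one).const_mul (2 * σ ^ 2 * x * √(s : ℝ))
  have i3 := (h3.mul_prod integrable_sq_gaussianReal_one).const_mul (t : ℝ)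
  rw [integral_sub ?_ (integrable_const _), integral_add ?_ i3, integral_add i1 i2,
    integral_const_mul, integral_const_mul, integral_const_mul,
    integral_prod_mul (fun r : ℝ => r) (fun _ : ℝ => (1 : ℝ)),
    integral_prod_mul (fun r : ℝ => √r * √(1 - r)) (fun z : ℝ => z),
    integral_prod_mul (fun r : ℝ => 1 - r) (fun z : ℝ => z ^ 2),
    integral_sq_gaussianReal_one, integral_sub (integrable_const _) h1,
    hG.integral_id_eq hψ hσ]
  rotate_left
  · exact i1.add i2
  · exact (i1.add i2).add i3
  have hpow : σ ^ 2 * σ ^ (-laplaceExponent G 1) =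
      ((t : ℝ) / s) ^ (1 - laplaceExponent G 1 / 2) := by
    rw [← hσ2, ← Real.rpow_natCast, ← Real.rpow_add (by linarith), ← Real.rpow_mul (by linarith)]
    congr 1
    push_cast
    ring
  rw [← hpow]
  simp
  rw [← hσs]
  ring

end TransitionMoments

/-! ### Conditional expectations and Gaussian marginals. -/

section Markov

variable {Ω : Type*} {mΩ : MeasurableSpace Ω} {μ : Measure Ω}
  {ℱ : Filtration ℝ≥0 mΩ} {G : ℝ → Measure ℝ} {X : ℝ≥0 → Ω → ℝ} {s t : ℝ≥0} {A : Set Ω}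

lemma IsMarkovProcessOf.measurable (hX : IsMarkovProcessOf G X ℱ μ) (t : ℝ≥0) :
    Measurable (X t) :=
  hX.isProgressive.adapted.measurable

variable [IsProbabilityMeasure μ]

lemma IsMarkovProcessOf.measureReal_restrict_map (hX : IsMarkovProcessOf G X ℱ μ) (hst : s < t)
    (hA : MeasurableSet[ℱ s] A) {B : Set ℝ} (hB : MeasurableSet B) :
    ((μ.restrict A).map (X t)).real B = ∫ ω in A, (transitionLaw G s t (X s ω)).real B ∂μ := by
  have hXB : MeasurableSet (X t ⁻¹' B) := hX.measurable t hB
  rw [map_measureReal_apply (hX.measurable t) hB,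
    setIntegral_congr_ae (ℱ.le s A hA) ((hX.markov s t hst B hB).symm.mono fun _ h _ => h),
    setIntegral_condExp (ℱ.le s) ((integrable_const _).indicator hXB) hA,
    integral_indicator_const _ hXB]
  simp

/-- Since X_0 = 0 almost surely, this says that X_t is independent of `ℱ 0` with law N(0, t); A = Ω
gives the marginal. -/
lemma IsMarkovProcessOf.restrict_map_eq_gaussianReal (hX : IsMarkovProcessOf G X ℱ μ) (ht : 0 < t)
    (hA : MeasurableSet[ℱ 0] A) :
    (μ.restrict A).map (X t) = μ A • gaussianReal 0 t := by
  ext B hB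
  refine (ENNReal.toReal_eq_toReal_iff' (measure_ne_top _ _) ?_).1 ?_
  · simpa using ENNReal.mul_ne_top (measure_ne_top _ _) (measure_ne_top _ _)
  rw [← measureReal_def, hX.measureReal_restrict_map ht hA hB]
  have : ∀ᵐ ω ∂(μ.restrict A), (transitionLaw G 0 t (X 0 ω)).real B
      = (gaussianReal 0 t).real B := by
    filter_upwards [ae_restrict_of_ae hX.start] with ω hω
    simp [transitionLaw, hω]
  rw [integral_congr_ae this]
  simp [measureReal_def]

lemma IsMarkovProcessOf.restrict_map_eq_prod_map (hX : IsMarkovProcessOf G X ℱ μ)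
    (hG : IsLogConvolutionSemigroup G) (hs : 0 < s) (hst : s < t) (hA : MeasurableSet[ℱ s] A) :
    (μ.restrict A).map (X t) =
      ((μ.restrict A).prod ((G (√((t : ℝ) / s))).prod (gaussianReal 0 1))).map
        fun z => transitionStep s t (X s z.1) z.2 := by
  have := hG.isProbabilityMeasure _ (one_le_sqrt_div hs hst.le)
  have hm : Measurable fun z : Ω × ℝ × ℝ => transitionStep s t (X s z.1) z.2 :=
    (measurable_transitionStep s t).comp
      (((hX.measurable s).comp measurable_fst).prodMk measurable_snd)
  ext B hB
  refine (ENNReal.toReal_eq_toReal_iff' (measure_ne_top _ _) (measure_ne_top _ _)).1 ?_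
  rw [← measureReal_def, hX.measureReal_restrict_map hst hA hB, Measure.map_apply hm hB,
    Measure.prod_apply (hm hB), ← integral_toReal ?_ (ae_of_all _ fun _ => measure_lt_top _ _)]
  rotate_left
  · exact (measurable_measure_prodMk_left (hm hB)).aemeasurable
  refine integral_congr_ae (ae_of_all _ fun ω => ?_)
  have hstep : Measurable (transitionStep s t (X s ω)) :=
    (measurable_transitionStep s t).comp measurable_prodMk_left
  simp only [transitionLaw_of_pos hs, measureReal_def, Measure.map_apply hstep hB]
  rfl

/-- The Markov property is given for indicators only. Stated as an identity of laws under
`μ.restrict A`, it extends to any integrable f, and Fubini produces g. -/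
lemma IsMarkovProcessOf.condExp_comp_of_pos (hX : IsMarkovProcessOf G X ℱ μ)
    (hG : IsLogConvolutionSemigroup G) (hs : 0 < s) (hst : s < t) {f g : ℝ → ℝ}
    (hf : Measurable f) (hg : Measurable g) (hfi : Integrable (fun ω => f (X t ω)) μ)
    (hgi : Integrable (fun ω => g (X s ω)) μ)
    (hfg : ∀ x, ∫ q, f (transitionStep s t x q)
      ∂((G (√((t : ℝ) / s))).prod (gaussianReal 0 1)) = g x) :
    μ[fun ω => f (X t ω) | ℱ s] =ᵐ[μ] fun ω => g (X s ω) := by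
  have := hG.isProbabilityMeasure _ (one_le_sqrt_div hs hst.le)
  symm
  refine ae_eq_condExp_of_forall_setIntegral_eq (ℱ.le s) hfi (fun _ _ _ => hgi.integrableOn)
    (fun A hA _ => ?_)
    (hg.comp (hX.isProgressive.adapted s)).stronglyMeasurable.aestronglyMeasurable
  have hm : Measurable fun z : Ω × ℝ × ℝ => transitionStep s t (X s z.1) z.2 :=
    (measurable_transitionStep s t).comp
      (((hX.measurable s).comp measurable_fst).prodMk measurable_snd)
  have hlaw := hX.restrict_map_eq_prod_map hG hs hst hA
  have hint : Integrable f ((μ.restrict A).map (X t)) :=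
    (integrable_map_measure hf.aestronglyMeasurable (hX.measurable t).aemeasurable).2
      hfi.integrableOn
  rw [← integral_map (hX.measurable t).aemeasurable hf.aestronglyMeasurable, hlaw,
    integral_map hm.aemeasurable hf.aestronglyMeasurable, integral_prod]
  · simp_rw [hfg]
  · rw [hlaw, integrable_map_measure hf.aestronglyMeasurable hm.aemeasurable] at hint
    exact hint

lemma IsMarkovProcessOf.condExp_comp_zero (hX : IsMarkovProcessOf G X ℱ μ) (ht : 0 < t)
    {f : ℝ → ℝ} (hf : Measurable f) (hfi : Integrable (fun ω => f (X t ω)) μ) :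
    μ[fun ω => f (X t ω) | ℱ 0] =ᵐ[μ] fun _ => ∫ x, f x ∂(gaussianReal 0 t) := by
  symm
  refine ae_eq_condExp_of_forall_setIntegral_eq (ℱ.le 0) hfi
    (fun _ _ _ => (integrable_const _).integrableOn) (fun A hA _ => ?_)
    stronglyMeasurable_const.aestronglyMeasurable
  rw [← integral_map (hX.measurable t).aemeasurable hf.aestronglyMeasurable,
    hX.restrict_map_eq_gaussianReal ht hA]
  simp [measureReal_def]

/-- Scaling from one standard Gaussian makes the constant in the second moment of X_t² - t
independent of t. -/
lemma gaussianReal_eq_map_sqrt_mul (t : ℝ≥0) :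
    gaussianReal 0 t = (gaussianReal 0 1).map (√(t : ℝ) * ·) := by
  rw [gaussianReal_map_const_mul]
  congr 1
  · simp
  · ext; simp

lemma IsMarkovProcessOf.map_eq (hX : IsMarkovProcessOf G X ℱ μ) (t : ℝ≥0) :
    μ.map (X t) = (gaussianReal 0 1).map (√(t : ℝ) * ·) := by
  rw [← gaussianReal_eq_map_sqrt_mul]
  rcases eq_or_ne t 0 with rfl | ht
  · rw [Measure.map_congr (g := fun _ => (0 : ℝ)) hX.start]
    simp [Measure.map_const]
  · have := hX.restrict_map_eq_gaussianReal (pos_iff_ne_zero.2 ht) (A := Set.univ) .univ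
    simpa using this

lemma IsMarkovProcessOf.memLp (hX : IsMarkovProcessOf G X ℱ μ) (t : ℝ≥0) (p : ℝ≥0) :
    MemLp (X t) p μ := by
  have h : MemLp id p (μ.map (X t)) := by
    rw [hX.map_eq, ← gaussianReal_eq_map_sqrt_mul]
    exact memLp_id_gaussianReal p
  exact (memLp_map_measure_iff (by fun_prop) (hX.measurable t).aemeasurable).1 h

lemma IsMarkovProcessOf.integral_comp (hX : IsMarkovProcessOf G X ℱ μ) (t : ℝ≥0) {f : ℝ → ℝ}
    (hf : Measurable f) : ∫ ω, f (X t ω) ∂μ = ∫ z, f (√(t : ℝ) * z) ∂(gaussianReal 0 1) := by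
  rw [← integral_map (hX.measurable t).aemeasurable hf.aestronglyMeasurable, hX.map_eq,
    integral_map (by fun_prop) hf.aestronglyMeasurable]

lemma IsMarkovProcessOf.integrable (hX : IsMarkovProcessOf G X ℱ μ) (t : ℝ≥0) :
    Integrable (X t) μ := (hX.memLp t 1).integrable (by simp)

lemma IsMarkovProcessOf.integrable_sq (hX : IsMarkovProcessOf G X ℱ μ) (t : ℝ≥0) :
    Integrable (fun ω => X t ω ^ 2) μ := (hX.memLp t 2).integrable_sq

lemma IsMarkovProcessOf.integral_sq (hX : IsMarkovProcessOf G X ℱ μ) (t : ℝ≥0) :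
    ∫ ω, X t ω ^ 2 ∂μ = t := by
  rw [hX.integral_comp t (f := fun x => x ^ 2) (by fun_prop)]
  simp_rw [mul_pow]
  rw [integral_const_mul, integral_sq_gaussianReal_one, Real.sq_sqrt t.coe_nonneg, mul_one]

lemma IsMarkovProcessOf.integrable_sq_sub (hX : IsMarkovProcessOf G X ℱ μ) (t : ℝ≥0) :
    Integrable (fun ω => X t ω ^ 2 - t) μ := (hX.integrable_sq t).sub (integrable_const _)

lemma IsMarkovProcessOf.memLp_two_sq_sub (hX : IsMarkovProcessOf G X ℱ μ) (t : ℝ≥0) :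
    MemLp (fun ω => X t ω ^ 2 - t) 2 μ := by
  refine MemLp.sub ?_ (memLp_const _)
  rw [memLp_two_iff_integrable_sq ((hX.measurable t).pow_const 2).aestronglyMeasurable]
  have := (hX.memLp t 4).integrable_norm_pow (p := 4) (by norm_num)
  refine this.congr (ae_of_all _ fun ω => ?_)
  simp only [Real.norm_eq_abs]
  rw [← pow_mul, Even.pow_abs (by decide)]

/-- The second moment of `X_t² - t` is proportional to `t²`. -/
lemma IsMarkovProcessOf.integral_sq_sub_sq (hX : IsMarkovProcessOf G X ℱ μ) (t : ℝ≥0) :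
    ∫ ω, (X t ω ^ 2 - t) ^ 2 ∂μ = (∫ z, (z ^ 2 - 1) ^ 2 ∂(gaussianReal 0 1)) * (t : ℝ) ^ 2 := by
  rw [hX.integral_comp t (f := fun x => (x ^ 2 - t) ^ 2) (by fun_prop), ← integral_mul_const]
  refine integral_congr_ae (ae_of_all _ fun z => ?_)
  simp only [mul_pow, Real.sq_sqrt t.coe_nonneg]
  ring

lemma IsMarkovProcessOf.condExp_eq (hX : IsMarkovProcessOf G X ℱ μ)
    (hG : IsLogConvolutionSemigroup G) (hψ : laplaceExponent G (1 / 2) = 1) (hst : s ≤ t) :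
    μ[X t | ℱ s] =ᵐ[μ] X s := by
  rcases hst.eq_or_lt with rfl | hst
  · rw [condExp_of_stronglyMeasurable (ℱ.le s) (hX.isProgressive.adapted s).stronglyMeasurable
      (hX.integrable s)]
  rcases eq_or_ne s 0 with rfl | hs
  · refine (hX.condExp_comp_zero hst (f := fun x => x) (by fun_prop) (hX.integrable t)).trans ?_
    filter_upwards [hX.start] with ω hω
    simp [hω]
  · exact hX.condExp_comp_of_pos hG (pos_iff_ne_zero.2 hs) hst (f := fun x => x)
      (g := fun x => x) (by fun_prop) (by fun_prop) (hX.integrable t) (hX.integrable s)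
      (integral_transitionStep hG hψ (pos_iff_ne_zero.2 hs) hst.le)

lemma IsMarkovProcessOf.condExp_sq_sub (hX : IsMarkovProcessOf G X ℱ μ)
    (hG : IsLogConvolutionSemigroup G) (hψ : laplaceExponent G (1 / 2) = 1) (hst : s < t) :
    μ[fun ω => X t ω ^ 2 - t | ℱ s] =ᵐ[μ]
      fun ω => ((t : ℝ) / s) ^ (1 - laplaceExponent G 1 / 2) * (X s ω ^ 2 - s) := by
  rcases eq_or_ne s 0 with rfl | hs
  · refine (hX.condExp_comp_zero hst (f := fun x => x ^ 2 - t) (by fun_prop)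
      (hX.integrable_sq_sub t)).trans ?_
    -- At s = 0 the power of t / 0 is a default value, multiplied by X_0² - 0 = 0; the left side is
    -- the centred Gaussian moment.
    filter_upwards [hX.start] with ω hω
    have h : ∫ x, (x ^ 2 - (t : ℝ)) ∂(gaussianReal 0 t) = 0 := by
      rw [gaussianReal_eq_map_sqrt_mul, integral_map (by fun_prop) (by fun_prop),
        ← hX.integral_comp t (f := fun x => x ^ 2 - t) (by fun_prop),
        integral_sub (hX.integrable_sq t) (integrable_const _), hX.integral_sq]
      simp
    simp [hω, h]
  · exact hX.condExp_comp_of_pos hG (pos_iff_ne_zero.2 hs) hst (f := fun x => x ^ 2 - t)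
      (g := fun x => ((t : ℝ) / s) ^ (1 - laplaceExponent G 1 / 2) * (x ^ 2 - s))
      (by fun_prop) (by fun_prop) (hX.integrable_sq_sub t) ((hX.integrable_sq_sub s).const_mul _)
      (integral_transitionStep_sq_sub hG hψ (pos_iff_ne_zero.2 hs) hst.le)

end Markov

/-! ### Measurability, predictability and finiteness of the time integral. -/

section TimeIntegral

variable {Ω : Type*} {mΩ : MeasurableSpace Ω} {ℱ : Filtration ℝ≥0 mΩ} {X : ℝ≥0 → Ω → ℝ}

/-- Stopping the time argument at t lets joint measurability with respect to `ℱ t` be used on all of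
ℝ × Ω. -/
lemma MeasureTheory.IsProgressive.measurable_min (hX : IsProgressive ℱ X) (t : ℝ≥0) :
    @Measurable (ℝ × Ω) ℝ (@Prod.instMeasurableSpace ℝ Ω _ (ℱ t)) _
      fun p => X (min p.1.toNNReal t) p.2 := by
  have h1 : Measurable fun x : ℝ =>
      (⟨min x.toNNReal t, Set.mem_Iic.2 (min_le_right _ _)⟩ : Set.Iic t) :=
    (measurable_real_toNNReal.min measurable_const).subtype_mk
  exact (hX t).comp ((h1.comp (@measurable_fst ℝ Ω _ (ℱ t))).prodMk (@measurable_snd ℝ Ω _ (ℱ t)))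

lemma MeasureTheory.IsProgressive.measurable_uncurry_toNNReal (hX : IsProgressive ℱ X) :
    Measurable fun p : ℝ × Ω => X p.1.toNNReal p.2 := by
  refine measurable_of_tendsto_metrizable (f := fun (n : ℕ) (p : ℝ × Ω) =>
    X (min p.1.toNNReal n) p.2) (fun n => ?_) (tendsto_pi_nhds.2 fun p => ?_)
  · exact (hX.measurable_min (n : ℝ≥0)).mono (sup_le_sup le_rfl
      (MeasurableSpace.comap_mono (ℱ.le _))) le_rfl
  · obtain ⟨n, hn⟩ := exists_nat_ge p.1.toNNReal
    refine tendsto_const_nhds.congr' ?_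
    filter_upwards [eventually_ge_atTop n] with m hm
    rw [min_eq_left (hn.trans (by exact_mod_cast hm))]

lemma MeasureTheory.IsProgressive.measurable_sq_div (hX : IsProgressive ℱ X) :
    Measurable fun p : ℝ × Ω => X p.1.toNNReal p.2 ^ 2 / p.1 :=
  (hX.measurable_uncurry_toNNReal.pow_const 2).div measurable_fst

/-- `∫_0^t X_s² / s ds` with values in `[0, ∞]`. -/
noncomputable def sqDivLIntegral (X : ℝ≥0 → Ω → ℝ) (t : ℝ≥0) (ω : Ω) : ℝ≥0∞ :=
  ∫⁻ s in Set.Ioc (0 : ℝ) t, ENNReal.ofReal (X s.toNNReal ω ^ 2 / s)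

lemma sqDivLIntegral_mono (X : ℝ≥0 → Ω → ℝ) (ω : Ω) : Monotone fun t => sqDivLIntegral X t ω :=
  fun _ _ hst => lintegral_mono_set (Set.Ioc_subset_Ioc_right (by exact_mod_cast hst))

lemma MeasureTheory.IsProgressive.measurable_sqDivLIntegral (hX : IsProgressive ℱ X) (t : ℝ≥0) :
    Measurable[ℱ t] (sqDivLIntegral X t) := by
  have h : @Measurable (ℝ × Ω) ℝ≥0∞ (@Prod.instMeasurableSpace ℝ Ω _ (ℱ t)) _
      fun p => ENNReal.ofReal (X (min p.1.toNNReal t) p.2 ^ 2 / p.1) :=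
    (((hX.measurable_min t).pow_const 2).div (@measurable_fst ℝ Ω _ (ℱ t))).ennreal_ofReal
  have h2 : Measurable[ℱ t] fun ω => ∫⁻ s in Set.Ioc (0 : ℝ) t,
      ENNReal.ofReal (X (min s.toNNReal t) ω ^ 2 / s) :=
    @Measurable.lintegral_prod_left' ℝ Ω _ (ℱ t) _ _ _ h
  convert h2 using 2 with ω
  refine setLIntegral_congr_fun measurableSet_Ioc fun s hs => ?_
  rw [min_eq_left (Real.toNNReal_le_iff_le_coe.2 hs.2)]

/-- `t ↦ ∫_0^t X_s² / s ds` is left-continuous. -/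
lemma exists_rat_lt_sqDivLIntegral {t : ℝ≥0} {ω : Ω} {a : ℝ≥0∞} (h : a < sqDivLIntegral X t ω) :
    ∃ q : ℚ, (q : ℝ).toNNReal < t ∧ a < sqDivLIntegral X (q : ℝ).toNNReal ω := by
  have ht : (0 : ℝ) < t := by
    by_contra hle
    rw [sqDivLIntegral, Set.Ioc_eq_empty hle] at h
    simp at h
  set ν := volume.withDensity fun s : ℝ => ENNReal.ofReal (X s.toNNReal ω ^ 2 / s)
  have hν : ∀ u : ℝ≥0, sqDivLIntegral X u ω = ν (Set.Ioc (0 : ℝ) u) := fun u =>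
    (withDensity_apply _ measurableSet_Ioc).symm
  have hU : Set.Ioo (0 : ℝ) t = ⋃ n : ℕ, Set.Ioc (0 : ℝ) (t - 1 / ((n : ℝ) + 1)) := by
    ext s
    simp only [Set.mem_Ioo, Set.mem_iUnion, Set.mem_Ioc]
    constructor
    · rintro ⟨h0, h1⟩
      obtain ⟨n, hn⟩ := exists_nat_one_div_lt (sub_pos.2 h1)
      exact ⟨n, h0, by linarith⟩
    · rintro ⟨n, h0, h1⟩
      have : 0 < 1 / ((n : ℝ) + 1) := by positivity
      exact ⟨h0, by linarith⟩
  have hmono : Monotone fun n : ℕ => Set.Ioc (0 : ℝ) (t - 1 / ((n : ℝ) + 1)) := by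
    intro m n hmn
    refine Set.Ioc_subset_Ioc_right ?_
    have := Nat.one_div_le_one_div (α := ℝ) hmn
    linarith
  have hIoo : ν (Set.Ioc (0 : ℝ) t) = ν (Set.Ioo (0 : ℝ) t) :=
    measure_congr ((withDensity_absolutelyContinuous _ _).ae_eq Ioo_ae_eq_Ioc.symm)
  rw [hν, hIoo, hU, hmono.measure_iUnion, lt_iSup_iff] at h
  obtain ⟨n, hn⟩ := h
  obtain ⟨q, hq1, hq2⟩ := exists_rat_btwn
    (show (t : ℝ) - 1 / ((n : ℝ) + 1) < t by
      have : 0 < 1 / ((n : ℝ) + 1) := by positivity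
      linarith)
  refine ⟨q, (Real.toNNReal_lt_toNNReal_iff ht).2 hq2 |>.trans_eq Real.toNNReal_coe, ?_⟩
  rw [hν]
  exact hn.trans_le
    (measure_mono (Set.Ioc_subset_Ioc_right (hq1.le.trans (Real.le_coe_toNNReal _))))

/-- By monotonicity and left-continuity, a superlevel set is a countable union of predictable
rectangles (q, ∞) × B with B in `ℱ q`. In [0, ∞] this needs no exceptional null set. -/
lemma MeasureTheory.IsProgressive.measurable_predictable_sqDivLIntegral (hX : IsProgressive ℱ X) :
    Measurable[ℱ.predictable] fun p : ℝ≥0 × Ω => sqDivLIntegral X p.1 p.2 := by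
  refine measurable_of_Ioi fun a => ?_
  have : (fun p : ℝ≥0 × Ω => sqDivLIntegral X p.1 p.2) ⁻¹' Set.Ioi a =
      ⋃ q : ℚ, Set.Ioi (q : ℝ).toNNReal ×ˢ (sqDivLIntegral X (q : ℝ).toNNReal ⁻¹' Set.Ioi a) := by
    ext p
    simp only [Set.mem_preimage, Set.mem_Ioi, Set.mem_iUnion, Set.mem_prod]
    constructor
    · exact exists_rat_lt_sqDivLIntegral
    · rintro ⟨q, hq, hq'⟩
      exact hq'.trans_le (sqDivLIntegral_mono X p.2 hq.le)
  rw [this]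
  exact MeasurableSet.iUnion fun q => measurableSet_predictable_Ioi_prod
    (hX.measurable_sqDivLIntegral _ measurableSet_Ioi)

lemma MeasureTheory.Filtration.measurable_predictable_fst (ℱ : Filtration ℝ≥0 mΩ) :
    Measurable[ℱ.predictable] fun p : ℝ≥0 × Ω => p.1 := by
  refine measurable_of_Ioi fun a => ?_
  have : (fun p : ℝ≥0 × Ω => p.1) ⁻¹' Set.Ioi a = Set.Ioi a ×ˢ Set.univ := by
    ext p; simp
  rw [this]
  exact measurableSet_predictable_Ioi_prod .univ

lemma sq_div_nonneg {s : ℝ} {t : ℝ≥0} (hs : s ∈ Set.Ioc (0 : ℝ) t) (ω : Ω) :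
    0 ≤ X s.toNNReal ω ^ 2 / s :=
  div_nonneg (sq_nonneg _) hs.1.le

/-- This holds for every ω: where the integral diverges, both sides take the default value 0. -/
lemma MeasureTheory.IsProgressive.intervalIntegral_sq_div (hX : IsProgressive ℱ X) (t : ℝ≥0)
    (ω : Ω) : ∫ s in (0 : ℝ)..t, X s.toNNReal ω ^ 2 / s = (sqDivLIntegral X t ω).toReal := by
  rw [intervalIntegral.integral_of_le t.coe_nonneg, integral_eq_lintegral_of_nonneg_ae]
  · rfl
  · exact (ae_restrict_mem measurableSet_Ioc).mono fun s hs => sq_div_nonneg hs ω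
  · exact (hX.measurable_sq_div.comp measurable_prodMk_right).aestronglyMeasurable

lemma MeasureTheory.IsProgressive.intervalIntegrable_sq_div (hX : IsProgressive ℱ X) {t : ℝ≥0}
    {ω : Ω} (h : sqDivLIntegral X t ω ≠ ∞) :
    IntervalIntegrable (fun s : ℝ => X s.toNNReal ω ^ 2 / s) volume 0 t := by
  rw [intervalIntegrable_iff_integrableOn_Ioc_of_le t.coe_nonneg]
  refine ⟨(hX.measurable_sq_div.comp measurable_prodMk_right).aestronglyMeasurable, ?_⟩
  rw [hasFiniteIntegral_iff_ofReal]
  · exact h.lt_top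
  · exact (ae_restrict_mem measurableSet_Ioc).mono fun s hs => sq_div_nonneg hs ω

lemma MeasureTheory.IsProgressive.isStronglyPredictable_quadVarFormula (hX : IsProgressive ℱ X)
    (δ : ℝ) : IsStronglyPredictable ℱ (quadVarFormula δ X) := by
  have h : Measurable[ℱ.predictable] fun p : ℝ≥0 × Ω =>
      δ * (p.1 : ℝ) + (1 - δ) * (sqDivLIntegral X p.1 p.2).toReal :=
    (ℱ.measurable_predictable_fst.coe_nnreal_real.const_mul δ).add
      (hX.measurable_predictable_sqDivLIntegral.ennreal_toReal.const_mul (1 - δ))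
  have e : Function.uncurry (quadVarFormula δ X) = fun p : ℝ≥0 × Ω =>
      δ * (p.1 : ℝ) + (1 - δ) * (sqDivLIntegral X p.1 p.2).toReal := by
    ext p
    simp only [Function.uncurry, quadVarFormula, hX.intervalIntegral_sq_div]
  rw [IsStronglyPredictable, e]
  exact h.stronglyMeasurable

lemma monotone_quadVarFormula {δ : ℝ} (h0 : 0 ≤ δ) (h1 : δ ≤ 1) (hX : IsProgressive ℱ X) {ω : Ω}
    (h : ∀ t, sqDivLIntegral X t ω ≠ ∞) : Monotone fun t => quadVarFormula δ X t ω := by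
  intro s t hst
  simp only [quadVarFormula, hX.intervalIntegral_sq_div]
  have := ENNReal.toReal_mono (h t) (sqDivLIntegral_mono X ω hst)
  have h1' : 0 ≤ 1 - δ := by linarith
  gcongr

lemma continuous_quadVarFormula (δ : ℝ) (hX : IsProgressive ℱ X) {ω : Ω}
    (h : ∀ t, sqDivLIntegral X t ω ≠ ∞) : Continuous fun t => quadVarFormula δ X t ω := by
  have hc : Continuous fun t : ℝ≥0 => ∫ s in (0 : ℝ)..t, X s.toNNReal ω ^ 2 / s := by
    rw [continuous_iff_continuousAt]
    intro t
    have hi := hX.intervalIntegrable_sq_div (h (t + 1))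
    have hcont := intervalIntegral.continuousOn_primitive_interval'
      hi Set.left_mem_uIcc
    rw [Set.uIcc_of_le (by positivity)] at hcont
    have hcomp : ContinuousOn (fun t : ℝ≥0 => ∫ s in (0 : ℝ)..t, X s.toNNReal ω ^ 2 / s)
        (Set.Iic (t + 1)) :=
      hcont.comp NNReal.continuous_coe.continuousOn fun u hu => ⟨u.2, by exact_mod_cast hu⟩
    exact hcomp.continuousAt (Iic_mem_nhds (by simp))
  unfold quadVarFormula
  fun_prop

variable {μ : Measure Ω} [IsProbabilityMeasure μ] {G : ℝ → Measure ℝ}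

/-- By Tonelli, since E[X_s²/s] = 1 for every s > 0. -/
lemma IsMarkovProcessOf.lintegral_sqDivLIntegral (hX : IsMarkovProcessOf G X ℱ μ) (t : ℝ≥0) :
    ∫⁻ ω, sqDivLIntegral X t ω ∂μ = t := by
  unfold sqDivLIntegral
  rw [lintegral_lintegral_swap]
  · have : ∀ s ∈ Set.Ioc (0 : ℝ) t,
        ∫⁻ ω, ENNReal.ofReal (X s.toNNReal ω ^ 2 / s) ∂μ = 1 := fun s hs => by
      rw [← ofReal_integral_eq_lintegral_ofReal ((hX.integrable_sq _).div_const s)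
        (ae_of_all _ fun ω => sq_div_nonneg hs ω), integral_div, hX.integral_sq,
        Real.coe_toNNReal _ hs.1.le, div_self hs.1.ne', ENNReal.ofReal_one]
    rw [setLIntegral_congr_fun measurableSet_Ioc this]
    simp
  · exact (hX.isProgressive.measurable_sq_div.ennreal_ofReal.comp measurable_swap).aemeasurable

lemma IsMarkovProcessOf.ae_sqDivLIntegral_ne_top (hX : IsMarkovProcessOf G X ℱ μ) :
    ∀ᵐ ω ∂μ, ∀ t, sqDivLIntegral X t ω ≠ ∞ := by
  -- Monotonicity in t reduces the uncountably many times to integers.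
  have h : ∀ᵐ ω ∂μ, ∀ n : ℕ, sqDivLIntegral X n ω < ∞ := by
    rw [ae_all_iff]
    intro n
    refine ae_lt_top ((hX.isProgressive.measurable_sqDivLIntegral _).mono (ℱ.le _) le_rfl) ?_
    rw [hX.lintegral_sqDivLIntegral]
    simp
  filter_upwards [h] with ω hω t
  obtain ⟨n, hn⟩ := exists_nat_ge t
  exact ((sqDivLIntegral_mono X ω hn).trans_lt (hω n)).ne

end TimeIntegral

/-! ### The martingale property of X² minus its bracket. -/

section Compensator

variable {Ω : Type*} {mΩ : MeasurableSpace Ω} {μ : Measure Ω}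
  {ℱ : Filtration ℝ≥0 mΩ} {G : ℝ → Measure ℝ} {X : ℝ≥0 → Ω → ℝ} {s t : ℝ≥0} {δ : ℝ}

/-- The integral form of f' = p f / u with f(s) = 1, solved by (u/s)^p. -/
lemma integral_rpow_div_div {s t : ℝ} (hs : 0 < s) (hst : s ≤ t) (p : ℝ) :
    p * ∫ u in s..t, (u / s) ^ p / u = (t / s) ^ p - 1 := by
  have hpos : ∀ u ∈ Set.uIcc s t, 0 < u := fun u hu => by
    rw [Set.uIcc_of_le hst] at hu
    exact hs.trans_le hu.1
  have hcont : ContinuousOn (fun u : ℝ => p * ((u / s) ^ p / u)) (Set.uIcc s t) := by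
    refine continuousOn_const.mul (ContinuousOn.div ?_ continuousOn_id fun u hu => (hpos u hu).ne')
    exact (continuousOn_id.div_const s).rpow_const fun u hu => .inl (div_pos (hpos u hu) hs).ne'
  rw [← intervalIntegral.integral_const_mul,
    intervalIntegral.integral_eq_sub_of_hasDerivAt (f := fun u => (u / s) ^ p) ?_
      hcont.intervalIntegrable, div_self hs.ne', Real.one_rpow]
  intro u hu
  have hu0 := hpos u hu
  have h := ((hasDerivAt_id u).div_const s).rpow_const (p := p) (.inl (div_pos hu0 hs).ne')
  refine h.congr_deriv ?_
  rw [id, Real.rpow_sub_one (div_pos hu0 hs).ne']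
  field_simp

lemma intervalIntegrable_rpow_div_div {s t : ℝ} (hs : 0 < s) (hst : s ≤ t) (p : ℝ) :
    IntervalIntegrable (fun u => (u / s) ^ p / u) volume s t := by
  have hpos : ∀ u ∈ Set.uIcc s t, 0 < u := fun u hu => by
    rw [Set.uIcc_of_le hst] at hu
    exact hs.trans_le hu.1
  refine ContinuousOn.intervalIntegrable
    (ContinuousOn.div ?_ continuousOn_id fun u hu => (hpos u hu).ne')
  exact (continuousOn_id.div_const s).rpow_const fun u hu => .inl (ne_of_gt (div_pos (hpos u hu) hs))

/-- The increments of `δ t + (1 - δ) ∫_0^t X_u² / u du` in terms of `X_u² - u`. -/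
lemma quadVarFormula_sub (δ : ℝ) {ω : Ω}
    (h : ∀ t : ℝ≥0, IntervalIntegrable (fun u : ℝ => X u.toNNReal ω ^ 2 / u) volume 0 t) :
    quadVarFormula δ X t ω - quadVarFormula δ X s ω =
      (t - s) + (1 - δ) * ∫ u in (s : ℝ)..t, (X u.toNNReal ω ^ 2 - u) / u := by
  have e : ∫ u in (s : ℝ)..t, (X u.toNNReal ω ^ 2 - u) / u =
      ∫ u in (s : ℝ)..t, (X u.toNNReal ω ^ 2 / u - 1) := by
    refine intervalIntegral.integral_congr_ae ?_
    filter_upwards [Measure.ae_ne volume (0 : ℝ)] with u hu _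
    field_simp
  rw [e, intervalIntegral.integral_sub ((h s).symm.trans (h t)) (by simp),
    ← intervalIntegral.integral_interval_sub_left (h t) (h s), quadVarFormula, quadVarFormula]
  simp
  ring

lemma IsMarkovProcessOf.setIntegral_zero (hX : IsMarkovProcessOf G X ℱ μ) (A : Set Ω) :
    ∫ ω in A, (X 0 ω ^ 2 - (0 : ℝ≥0)) ∂μ = 0 := by
  refine (integral_congr_ae ?_).trans (integral_zero' _ _)
  filter_upwards [ae_restrict_of_ae hX.start] with ω hω
  simp [hω]

variable [IsProbabilityMeasure μ]

lemma IsMarkovProcessOf.ae_intervalIntegrable (hX : IsMarkovProcessOf G X ℱ μ) :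
    ∀ᵐ ω ∂μ, ∀ t : ℝ≥0,
      IntervalIntegrable (fun u : ℝ => X u.toNNReal ω ^ 2 / u) volume 0 t := by
  filter_upwards [hX.ae_sqDivLIntegral_ne_top] with ω hω t
  exact hX.isProgressive.intervalIntegrable_sq_div (hω t)

lemma IsMarkovProcessOf.integrable_prod_sq_sub_div (hX : IsMarkovProcessOf G X ℱ μ)
    (s t : ℝ≥0) (A : Set Ω) :
    Integrable (fun z : Ω × ℝ => (X z.2.toNNReal z.1 ^ 2 - z.2) / z.2)
      ((μ.restrict A).prod (volume.restrict (Set.Ioc (s : ℝ) t))) := by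
  have hm : Measurable fun z : Ω × ℝ => X z.2.toNNReal z.1 ^ 2 / z.2 :=
    hX.isProgressive.measurable_sq_div.comp measurable_swap
  have h : Integrable (fun z : Ω × ℝ => X z.2.toNNReal z.1 ^ 2 / z.2)
      (μ.prod (volume.restrict (Set.Ioc (0 : ℝ) t))) := by
    refine ⟨hm.aestronglyMeasurable, ?_⟩
    rw [hasFiniteIntegral_iff_enorm, lintegral_prod _ hm.enorm.aemeasurable]
    calc _ = ∫⁻ ω, sqDivLIntegral X t ω ∂μ := by
          refine lintegral_congr fun ω => setLIntegral_congr_fun measurableSet_Ioc fun u hu => ?_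
          exact Real.enorm_of_nonneg (sq_div_nonneg hu ω)
      _ < ∞ := by
          rw [hX.lintegral_sqDivLIntegral]
          exact ENNReal.coe_lt_top
  have hle : (μ.restrict A).prod (volume.restrict (Set.Ioc (s : ℝ) t)) ≤
      μ.prod (volume.restrict (Set.Ioc (0 : ℝ) t)) :=
    Measure.prod_mono Measure.restrict_le_self
      (Measure.restrict_mono (Set.Ioc_subset_Ioc_left s.2) le_rfl)
  refine ((h.mono_measure hle).sub (integrable_const 1)).congr ?_
  have h0 : ∀ᵐ z ∂((μ.restrict A).prod (volume.restrict (Set.Ioc (s : ℝ) t))), z.2 ≠ 0 :=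
    Measure.quasiMeasurePreserving_snd.ae (ae_restrict_of_ae (Measure.ae_ne volume (0 : ℝ)))
  filter_upwards [h0] with z hz
  simp only [Pi.sub_apply]
  field_simp

lemma IsMarkovProcessOf.setIntegral_sq_sub (hX : IsMarkovProcessOf G X ℱ μ)
    (hG : IsLogConvolutionSemigroup G) (hψ : laplaceExponent G (1 / 2) = 1)
    (hδ : δ = laplaceExponent G 1 / 2) (hst : s < t) {A : Set Ω} (hA : MeasurableSet[ℱ s] A) :
    ∫ ω in A, (X t ω ^ 2 - t) ∂μ =
      ((t : ℝ) / s) ^ (1 - δ) * ∫ ω in A, (X s ω ^ 2 - s) ∂μ := by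
  rw [← setIntegral_condExp (ℱ.le s) (hX.integrable_sq_sub t) hA, ← integral_const_mul]
  refine setIntegral_congr_ae (ℱ.le s A hA) ?_
  filter_upwards [hX.condExp_sq_sub hG hψ hst] with ω hω _
  rw [hω, hδ]

/-- Write a_u for the integral of X_u² - u over A. Then a_u = (u/s)^(1-δ) a_s, so Fubini and the
equation solved by the power give (1-δ) ∫_s^t a_u/u du = a_t - a_s. -/
lemma IsMarkovProcessOf.setIntegral_compensator (hX : IsMarkovProcessOf G X ℱ μ)
    (hG : IsLogConvolutionSemigroup G) (hψ : laplaceExponent G (1 / 2) = 1)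
    (hδ : δ = laplaceExponent G 1 / 2) (hst : s < t) {A : Set Ω} (hA : MeasurableSet[ℱ s] A) :
    (1 - δ) * ∫ ω in A, (∫ u in (s : ℝ)..t, (X u.toNNReal ω ^ 2 - u) / u) ∂μ =
      ∫ ω in A, (X t ω ^ 2 - t) ∂μ - ∫ ω in A, (X s ω ^ 2 - s) ∂μ := by
  have hst' : (s : ℝ) ≤ t := by exact_mod_cast hst.le
  set a := ∫ ω in A, (X s ω ^ 2 - s) ∂μ with ha
  have e : ∫ ω in A, (∫ u in (s : ℝ)..t, (X u.toNNReal ω ^ 2 - u) / u) ∂μ =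
      (∫ u in (s : ℝ)..t, (u / s) ^ (1 - δ) / u) * a := by
    simp_rw [intervalIntegral.integral_of_le hst']
    rw [integral_integral_swap (hX.integrable_prod_sq_sub_div s t A), ← integral_mul_const]
    refine setIntegral_congr_fun measurableSet_Ioc fun u hu => ?_
    have hu0 : 0 ≤ u := s.2.trans hu.1.le
    have hsu : s < u.toNNReal := Real.lt_toNNReal_iff_coe_lt.2 hu.1
    have := hX.setIntegral_sq_sub hG hψ hδ hsu hA
    simp only [Real.coe_toNNReal u hu0] at this
    rw [integral_div, this]
    ring
  rw [e, hX.setIntegral_sq_sub hG hψ hδ hst hA, ← mul_assoc]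
  -- At s = 0 the powers of u / 0 are default values, harmless because a = 0.
  rcases eq_or_ne s 0 with rfl | hs
  · rw [ha, hX.setIntegral_zero]
    simp
  · rw [integral_rpow_div_div (by exact_mod_cast pos_iff_ne_zero.2 hs) hst']
    ring

lemma IsMarkovProcessOf.integrable_quadVarFormula (hX : IsMarkovProcessOf G X ℱ μ) (δ : ℝ)
    (t : ℝ≥0) : Integrable (quadVarFormula δ X t) μ := by
  have h : Integrable (fun ω => (sqDivLIntegral X t ω).toReal) μ := by
    refine integrable_toReal_of_lintegral_ne_top
      ((hX.isProgressive.measurable_sqDivLIntegral t).mono (ℱ.le t) le_rfl).aemeasurable ?_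
    rw [hX.lintegral_sqDivLIntegral]
    exact ENNReal.coe_ne_top
  unfold quadVarFormula
  simp_rw [hX.isProgressive.intervalIntegral_sq_div]
  exact (integrable_const _).add (h.const_mul _)

lemma IsMarkovProcessOf.martingale (hX : IsMarkovProcessOf G X ℱ μ)
    (hG : IsLogConvolutionSemigroup G) (hψ : laplaceExponent G (1 / 2) = 1) :
    Martingale X ℱ μ :=
  ⟨fun t => (hX.isProgressive.adapted t).stronglyMeasurable,
    fun _ _ hst => hX.condExp_eq hG hψ hst⟩

lemma IsMarkovProcessOf.martingale_sq_sub_quadVarFormula (hX : IsMarkovProcessOf G X ℱ μ)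
    (hG : IsLogConvolutionSemigroup G) (hψ : laplaceExponent G (1 / 2) = 1)
    (hδ : δ = laplaceExponent G 1 / 2) :
    Martingale (fun t ω => X t ω ^ 2 - quadVarFormula δ X t ω) ℱ μ := by
  have hadapt : StronglyAdapted ℱ fun t ω => X t ω ^ 2 - quadVarFormula δ X t ω := fun t =>
    ((hX.isProgressive.adapted t).stronglyMeasurable.pow 2).sub
      ((hX.isProgressive.isStronglyPredictable_quadVarFormula δ).stronglyAdapted t)
  have hint : ∀ t, Integrable (fun ω => X t ω ^ 2 - quadVarFormula δ X t ω) μ := fun t =>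
    (hX.integrable_sq t).sub (hX.integrable_quadVarFormula δ t)
  refine ⟨hadapt, fun s t hst => ?_⟩
  rcases hst.eq_or_lt with rfl | hst
  · rw [condExp_of_stronglyMeasurable (ℱ.le s) (hadapt s) (hint s)]
  refine (ae_eq_condExp_of_forall_setIntegral_eq (ℱ.le s) (hint t)
    (fun _ _ _ => (hint s).integrableOn) (fun A hA _ => ?_)
    (hadapt s).aestronglyMeasurable).symm
  have key := hX.setIntegral_compensator hG hψ hδ hst hA
  have hst' : (s : ℝ) ≤ t := by exact_mod_cast hst.le
  have hsub : ∀ᵐ ω ∂(μ.restrict A), X t ω ^ 2 - quadVarFormula δ X t ω =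
      (X s ω ^ 2 - quadVarFormula δ X s ω) + ((X t ω ^ 2 - t) - (X s ω ^ 2 - s)
        - (1 - δ) * ∫ u in (s : ℝ)..t, (X u.toNNReal ω ^ 2 - u) / u) := by
    filter_upwards [ae_restrict_of_ae hX.ae_intervalIntegrable] with ω hω
    have := quadVarFormula_sub (s := s) (t := t) δ hω
    linarith
  have hi : Integrable (fun ω => ∫ u in (s : ℝ)..t, (X u.toNNReal ω ^ 2 - u) / u)
      (μ.restrict A) := by
    simp_rw [intervalIntegral.integral_of_le hst']
    exact (hX.integrable_prod_sq_sub_div s t A).integral_prod_left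
  have hYt := (hX.integrable_sq_sub t).integrableOn (s := A)
  have hYs := (hX.integrable_sq_sub s).integrableOn (s := A)
  have hYts : Integrable (fun ω => (X t ω ^ 2 - t) - (X s ω ^ 2 - s)) (μ.restrict A) :=
    hYt.sub hYs
  have hD : Integrable (fun ω => (X t ω ^ 2 - t) - (X s ω ^ 2 - s)
      - (1 - δ) * ∫ u in (s : ℝ)..t, (X u.toNNReal ω ^ 2 - u) / u) (μ.restrict A) :=
    hYts.sub (hi.const_mul _)
  rw [integral_congr_ae hsub, integral_add (hint s).integrableOn hD,
    integral_sub hYts (hi.const_mul _), integral_sub hYt hYs, integral_const_mul, key]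
  ring

end Compensator

/-! ### Telescoping sums over a subdivision. -/

section Subdivisions

lemma Fin.sum_succ_sub_castSucc {n : ℕ} (f : Fin (n + 1) → ℝ) :
    ∑ k : Fin n, (f k.succ - f k.castSucc) = f (Fin.last n) - f 0 := by
  induction n with
  | zero => simp
  | succ n ih =>
    rw [Fin.sum_univ_castSucc]
    have := ih fun k => f k.castSucc
    simp only [Fin.succ_castSucc, Fin.castSucc_zero] at this ⊢
    rw [this, Fin.succ_last]
    ring

lemma Subdivision.sub_le_mesh {t : ℝ≥0} (π : Subdivision t) (k : Fin π.n) :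
    π.pt k.succ - π.pt k.castSucc ≤ π.mesh :=
  Finset.le_sup (f := fun k : Fin π.n => π.pt k.succ - π.pt k.castSucc) (Finset.mem_univ k)

end Subdivisions

/-! ### Convergence of the sums of conditional variances. -/

section ConditionalVariance

variable {Ω : Type*} {mΩ : MeasurableSpace Ω} {μ : Measure Ω} [IsProbabilityMeasure μ]
  {ℱ : Filtration ℝ≥0 mΩ} {G : ℝ → Measure ℝ} {X : ℝ≥0 → Ω → ℝ} {s t : ℝ≥0} {δ : ℝ}

lemma IsMarkovProcessOf.condExp_increment_sq (hX : IsMarkovProcessOf G X ℱ μ)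
    (hG : IsLogConvolutionSemigroup G) (hψ : laplaceExponent G (1 / 2) = 1)
    (hδ : δ = laplaceExponent G 1 / 2) (hst : s < t) :
    μ[fun ω => (X t ω - X s ω) ^ 2 | ℱ s] =ᵐ[μ]
      fun ω => (((t : ℝ) / s) ^ (1 - δ) - 1) * (X s ω ^ 2 - s) + (t - s) := by
  have hXs : StronglyMeasurable[ℱ s] (X s) := (hX.isProgressive.adapted s).stronglyMeasurable
  have hmul : Integrable (X s * X t) μ := by
    have h2 : ∀ r, MemLp (X r) 2 μ := fun r => hX.memLp r 2
    exact (h2 s).integrable_mul (h2 t)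
  -- Isolates X_t² - t, whose conditional expectation is known; X_s is pulled out of the product X_s
  -- X_t.
  have e : (fun ω => (X t ω - X s ω) ^ 2) =
      ((fun ω => X t ω ^ 2 - t) - (2 : ℝ) • (X s * X t)) + fun ω => X s ω ^ 2 + t := by
    ext ω
    simp only [Pi.add_apply, Pi.sub_apply, Pi.smul_apply, Pi.mul_apply, smul_eq_mul]
    ring
  have hi : Integrable (fun ω => X s ω ^ 2 + (t : ℝ)) μ :=
    (hX.integrable_sq s).add (integrable_const _)
  have h1 := condExp_add ((hX.integrable_sq_sub t).sub (hmul.smul (2 : ℝ))) hi (ℱ s)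
  have h2 := condExp_sub (hX.integrable_sq_sub t) (hmul.smul (2 : ℝ)) (ℱ s)
  have h3 := condExp_smul (μ := μ) (2 : ℝ) (X s * X t) (ℱ s)
  have h4 := condExp_mul_of_stronglyMeasurable_left hXs hmul (hX.integrable t)
  have h5 := condExp_of_stronglyMeasurable (ℱ.le s) (f := fun ω => X s ω ^ 2 + (t : ℝ))
    ((hXs.pow 2).add stronglyMeasurable_const) hi
  rw [e]
  filter_upwards [h1, h2, h3, h4, hX.condExp_sq_sub hG hψ hst, hX.condExp_eq hG hψ hst.le]
    with ω h1 h2 h3 h4 h6 h7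
  rw [h1, Pi.add_apply, h2, Pi.sub_apply, h3, Pi.smul_apply, h4, Pi.mul_apply, h5, h6, h7, hδ]
  simp only [smul_eq_mul]
  ring

/-- The conditional expectation given `ℱ s` is already a function of X_s, so the tower property
leaves it unchanged. -/
lemma IsMarkovProcessOf.condExp_comap_increment_sq (hX : IsMarkovProcessOf G X ℱ μ)
    (hG : IsLogConvolutionSemigroup G) (hψ : laplaceExponent G (1 / 2) = 1)
    (hδ : δ = laplaceExponent G 1 / 2) (hst : s < t) :
    μ[fun ω => (X t ω - X s ω) ^ 2 | MeasurableSpace.comap (X s) inferInstance] =ᵐ[μ]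
      fun ω => (((t : ℝ) / s) ^ (1 - δ) - 1) * (X s ω ^ 2 - s) + (t - s) := by
  have hle : MeasurableSpace.comap (X s) inferInstance ≤ ℱ s :=
    (hX.isProgressive.adapted s).comap_le
  refine (condExp_condExp_of_le hle (ℱ.le s)).symm.trans
    ((condExp_congr_ae (hX.condExp_increment_sq hG hψ hδ hst)).trans ?_)
  rw [condExp_of_stronglyMeasurable (hle.trans (ℱ.le s))]
  · have hm : Measurable fun x : ℝ => (((t : ℝ) / s) ^ (1 - δ) - 1) * (x ^ 2 - s) + (t - s) := by
      fun_prop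
    exact (hm.comp (comap_measurable (X s))).stronglyMeasurable
  · exact ((hX.integrable_sq_sub s).const_mul _).add (integrable_const _)

/-- The conditional variance of an increment differs from the increment of `⟨X, X⟩` by an integral
of the martingale increments `X_u² - u - E[X_u² - u | ℱ s]`. -/
lemma IsMarkovProcessOf.condExp_comap_sub_quadVarFormula (hX : IsMarkovProcessOf G X ℱ μ)
    (hG : IsLogConvolutionSemigroup G) (hψ : laplaceExponent G (1 / 2) = 1)
    (hδ : δ = laplaceExponent G 1 / 2) (hst : s < t) :
    ∀ᵐ ω ∂μ, (μ[fun ω => (X t ω - X s ω) ^ 2 | MeasurableSpace.comap (X s) inferInstance]) ω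
        - (quadVarFormula δ X t ω - quadVarFormula δ X s ω) =
      (1 - δ) * ∫ u in (s : ℝ)..t,
        ((u / s) ^ (1 - δ) * (X s ω ^ 2 - s) - (X u.toNNReal ω ^ 2 - u)) / u := by
  have hst' : (s : ℝ) ≤ t := by exact_mod_cast hst.le
  filter_upwards [hX.condExp_comap_increment_sq hG hψ hδ hst, hX.ae_intervalIntegrable, hX.start]
    with ω h1 h2 h3
  rw [h1, quadVarFormula_sub δ h2]
  rcases eq_or_ne s 0 with rfl | hs
  · have e : ∀ u : ℝ, ((u / (0 : ℝ≥0)) ^ (1 - δ) * (X 0 ω ^ 2 - (0 : ℝ≥0))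
        - (X u.toNNReal ω ^ 2 - u)) / u = -((X u.toNNReal ω ^ 2 - u) / u) := fun u => by
      rw [h3, NNReal.coe_zero]
      ring
    simp_rw [e]
    rw [intervalIntegral.integral_neg, h3, NNReal.coe_zero]
    ring
  · have hs' : (0 : ℝ) < s := by exact_mod_cast pos_iff_ne_zero.2 hs
    have hi := (intervalIntegrable_rpow_div_div hs' hst' (1 - δ)).mul_const (X s ω ^ 2 - s)
    have hi2 : IntervalIntegrable (fun u : ℝ => (X u.toNNReal ω ^ 2 - u) / u) volume s t := by
      have := ((h2 s).symm.trans (h2 t)).sub (intervalIntegrable_const (c := (1 : ℝ)))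
      refine this.congr_ae ?_
      filter_upwards [ae_restrict_of_ae (Measure.ae_ne volume (0 : ℝ))] with u hu
      field_simp
    have e : ∀ u : ℝ, ((u / s) ^ (1 - δ) * (X s ω ^ 2 - s) - (X u.toNNReal ω ^ 2 - u)) / u =
        (u / s) ^ (1 - δ) / u * (X s ω ^ 2 - s) - (X u.toNNReal ω ^ 2 - u) / u := fun u => by ring
    simp_rw [e]
    rw [intervalIntegral.integral_sub hi hi2, intervalIntegral.integral_mul_const,
      ← integral_rpow_div_div hs' hst' (1 - δ)]
    ring

/-- The variance of |f| is nonnegative. -/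
lemma integral_abs_le_sqrt {f : Ω → ℝ} (hf : MemLp f 2 μ) :
    ∫ ω, |f ω| ∂μ ≤ √(∫ ω, f ω ^ 2 ∂μ) := by
  refine Real.le_sqrt_of_sq_le ?_
  have h := variance_nonneg |f| μ
  rw [variance_eq_sub hf.abs] at h
  simp only [Pi.pow_apply, Pi.abs_apply, sq_abs] at h
  linarith

lemma IsMarkovProcessOf.integral_mul_sq_sub (hX : IsMarkovProcessOf G X ℱ μ)
    (hG : IsLogConvolutionSemigroup G) (hψ : laplaceExponent G (1 / 2) = 1)
    (hδ : δ = laplaceExponent G 1 / 2) (hst : s < t) :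
    ∫ ω, (X s ω ^ 2 - s) * (X t ω ^ 2 - t) ∂μ =
      ((t : ℝ) / s) ^ (1 - δ) * ∫ ω, (X s ω ^ 2 - s) ^ 2 ∂μ := by
  have hXs : StronglyMeasurable[ℱ s] fun ω => X s ω ^ 2 - (s : ℝ) :=
    ((hX.isProgressive.adapted s).stronglyMeasurable.pow 2).sub stronglyMeasurable_const
  have hmul : Integrable ((fun ω => X s ω ^ 2 - (s : ℝ)) * fun ω => X t ω ^ 2 - (t : ℝ)) μ :=
    (hX.memLp_two_sq_sub s).integrable_mul (hX.memLp_two_sq_sub t)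
  have h := integral_condExp (μ := μ) (ℱ.le s)
    (f := (fun ω => X s ω ^ 2 - (s : ℝ)) * fun ω => X t ω ^ 2 - (t : ℝ))
  simp only [Pi.mul_apply] at h
  rw [← h, ← integral_const_mul]
  refine integral_congr_ae ?_
  filter_upwards [condExp_mul_of_stronglyMeasurable_left hXs hmul (hX.integrable_sq_sub t),
    hX.condExp_sq_sub hG hψ hst] with ω h1 h2
  rw [h1, Pi.mul_apply, h2, hδ]
  ring

/-- With Y_t = X_t² - t and c the power, c Y_s is the projection of Y_t on `ℱ s`. The squared L²
distance is therefore E[Y_t²] - c² E[Y_s²] = K (t² - c² s²), and c² s² ≥ s² because δ ≤ 1. -/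
lemma IsMarkovProcessOf.integral_abs_sq_sub_le (hX : IsMarkovProcessOf G X ℱ μ)
    (hG : IsLogConvolutionSemigroup G) (hψ : laplaceExponent G (1 / 2) = 1)
    (hδ : δ = laplaceExponent G 1 / 2) (hst : s < t) :
    ∫ ω, |((t : ℝ) / s) ^ (1 - δ) * (X s ω ^ 2 - s) - (X t ω ^ 2 - t)| ∂μ ≤
      √(2 * (∫ z, (z ^ 2 - 1) ^ 2 ∂(gaussianReal 0 1)) * t * (t - s)) := by
  set K := ∫ z, (z ^ 2 - 1) ^ 2 ∂(gaussianReal 0 1) with hK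
  have hK0 : 0 ≤ K := integral_nonneg fun z => sq_nonneg _
  set c := ((t : ℝ) / s) ^ (1 - δ) with hc
  have hst' : (s : ℝ) ≤ t := by exact_mod_cast hst.le
  have hYs := hX.memLp_two_sq_sub s
  have hYt := hX.memLp_two_sq_sub t
  refine (integral_abs_le_sqrt ((hYs.const_mul c).sub hYt)).trans (Real.sqrt_le_sqrt ?_)
  have e : ∀ ω, (c * (X s ω ^ 2 - s) - (X t ω ^ 2 - t)) ^ 2 =
      c ^ 2 * (X s ω ^ 2 - s) ^ 2 - 2 * c * ((X s ω ^ 2 - s) * (X t ω ^ 2 - t))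
        + (X t ω ^ 2 - t) ^ 2 := fun ω => by ring
  have i1 : Integrable (fun ω => c ^ 2 * (X s ω ^ 2 - s) ^ 2) μ := hYs.integrable_sq.const_mul _
  have i2 : Integrable (fun ω => 2 * c * ((X s ω ^ 2 - s) * (X t ω ^ 2 - t))) μ :=
    (hYs.integrable_mul hYt).const_mul _
  have i3 : Integrable (fun ω => c ^ 2 * (X s ω ^ 2 - s) ^ 2
      - 2 * c * ((X s ω ^ 2 - s) * (X t ω ^ 2 - t))) μ := i1.sub i2
  simp only [Pi.sub_apply]
  simp_rw [e]
  rw [integral_add i3 hYt.integrable_sq, integral_sub i1 i2, integral_const_mul,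
    integral_const_mul, hX.integral_mul_sq_sub hG hψ hδ hst, hX.integral_sq_sub_sq,
    hX.integral_sq_sub_sq, ← hc, ← hK]
  have hcs : (s : ℝ) ^ 2 ≤ c ^ 2 * (s : ℝ) ^ 2 := by
    rcases eq_or_ne s 0 with rfl | hs
    · simp
    · have hs' : (0 : ℝ) < s := by exact_mod_cast pos_iff_ne_zero.2 hs
      have hc1 : 1 ≤ c := Real.one_le_rpow ((one_le_div hs').2 hst') (by
        have := laplaceExponent_one_le_two hG hψ
        linarith)
      exact le_mul_of_one_le_left (sq_nonneg _) (one_le_pow₀ hc1)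
  -- After `hcs`, the inequality t² - s² ≤ 2t(t - s) amounts to (t - s)² ≥ 0.
  have h1 : (t : ℝ) ^ 2 - c ^ 2 * (s : ℝ) ^ 2 ≤ 2 * (t * (t - s)) := by
    nlinarith [sq_nonneg ((t : ℝ) - s)]
  nlinarith [mul_le_mul_of_nonneg_left h1 hK0]

lemma lintegral_Ioc_ofReal_mul_rpow {s t C : ℝ} (hs : 0 ≤ s) (hst : s ≤ t) (hC : 0 ≤ C) :
    ∫⁻ u in Set.Ioc s t, ENNReal.ofReal (C * u ^ (-(1 / 2) : ℝ)) =
      ENNReal.ofReal (2 * C * (√t - √s)) := by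
  have hi : IntervalIntegrable (fun u : ℝ => C * u ^ (-(1 / 2) : ℝ)) volume s t :=
    (intervalIntegral.intervalIntegrable_rpow' (by norm_num)).const_mul C
  rw [← ofReal_integral_eq_lintegral_ofReal
    ((intervalIntegrable_iff_integrableOn_Ioc_of_le hst).1 hi),
    ← intervalIntegral.integral_of_le hst, intervalIntegral.integral_const_mul,
    integral_rpow (.inl (by norm_num))]
  · rw [Real.sqrt_eq_rpow, Real.sqrt_eq_rpow]
    norm_num
    ring_nf
  · filter_upwards [ae_restrict_mem measurableSet_Ioc] with u hu
    have : 0 ≤ u := hs.trans hu.1.le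
    simp only [Pi.zero_apply]
    positivity

/-- The factor 1/u turns the bound √(2K u (u-s)) into at most √(2K m) u^(-1/2), integrable at 0 with
primitive 2√u. Keeping m separate from t - s leaves a bound that telescopes. -/
lemma IsMarkovProcessOf.lintegral_condExp_comap_sub_quadVarFormula_le
    (hX : IsMarkovProcessOf G X ℱ μ) (hG : IsLogConvolutionSemigroup G)
    (hψ : laplaceExponent G (1 / 2) = 1) (hδ : δ = laplaceExponent G 1 / 2) (hst : s < t)
    {m : ℝ} (hm : (t : ℝ) - s ≤ m) :
    ∫⁻ ω, ‖(μ[fun ω => (X t ω - X s ω) ^ 2 | MeasurableSpace.comap (X s) inferInstance]) ω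
        - (quadVarFormula δ X t ω - quadVarFormula δ X s ω)‖ₑ ∂μ ≤
      ENNReal.ofReal (2 * √(2 * (∫ z, (z ^ 2 - 1) ^ 2 ∂(gaussianReal 0 1)) * m)
        * (√(t : ℝ) - √(s : ℝ))) := by
  set K := ∫ z, (z ^ 2 - 1) ^ 2 ∂(gaussianReal 0 1) with hK
  have hK0 : 0 ≤ K := integral_nonneg fun z => sq_nonneg _
  have hst' : (s : ℝ) ≤ t := by exact_mod_cast hst.le
  have hδ0 := laplaceExponent_one_nonneg hG hψ
  have hδ2 := laplaceExponent_one_le_two hG hψ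
  set Z : Ω → ℝ → ℝ := fun ω u =>
    ((u / s) ^ (1 - δ) * (X s ω ^ 2 - s) - (X u.toNNReal ω ^ 2 - u)) / u with hZ
  have hZm : Measurable (Function.uncurry Z) := by
    have h1 : Measurable fun z : Ω × ℝ => X z.2.toNNReal z.1 :=
      hX.isProgressive.measurable_uncurry_toNNReal.comp measurable_swap
    have h2 := hX.measurable s
    have h3 : Measurable fun z : Ω × ℝ => X s z.1 := h2.comp measurable_fst
    simp only [hZ, Function.uncurry_def]
    exact ((((measurable_snd.div_const _).pow_const _).mul
      ((h3.pow_const 2).sub_const _)).sub ((h1.pow_const 2).sub measurable_snd)).div measurable_snd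
  calc _ ≤ ∫⁻ ω, (∫⁻ u in Set.Ioc (s : ℝ) t, ‖Z ω u‖ₑ) ∂μ := by
        refine lintegral_mono_ae ?_
        filter_upwards [hX.condExp_comap_sub_quadVarFormula hG hψ hδ hst] with ω hω
        rw [hω, enorm_mul, intervalIntegral.integral_of_le hst']
        -- The factor 1 - δ lies in [0, 1] and is dropped.
        refine (mul_le_of_le_one_left' ?_).trans (enorm_integral_le_lintegral_enorm _)
        rw [Real.enorm_of_nonneg (by linarith), ENNReal.ofReal_le_one]
        linarith
    _ = ∫⁻ u in Set.Ioc (s : ℝ) t, ∫⁻ ω, ‖Z ω u‖ₑ ∂μ :=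
        lintegral_lintegral_swap hZm.enorm.aemeasurable
    _ ≤ ∫⁻ u in Set.Ioc (s : ℝ) t, ENNReal.ofReal (√(2 * K * m) * u ^ (-(1 / 2) : ℝ)) := by
        refine setLIntegral_mono_ae (by fun_prop) (ae_of_all _ fun u hu => ?_)
        have hu0 : 0 < u := s.2.trans_lt hu.1
        have hsu : s < u.toNNReal := Real.lt_toNNReal_iff_coe_lt.2 hu.1
        have hb := hX.integral_abs_sq_sub_le hG hψ hδ hsu
        simp only [Real.coe_toNNReal u hu0.le, ← hK] at hb
        have hYi : Integrable (fun ω => (u / s) ^ (1 - δ) * (X s ω ^ 2 - s)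
            - (X u.toNNReal ω ^ 2 - u)) μ := by
          have := hX.integrable_sq_sub u.toNNReal
          rw [Real.coe_toNNReal u hu0.le] at this
          exact ((hX.integrable_sq_sub s).const_mul _).sub this
        rw [← ofReal_integral_norm_eq_lintegral_enorm (hYi.div_const u)]
        refine ENNReal.ofReal_le_ofReal ?_
        simp only [Real.norm_eq_abs, abs_div, abs_of_pos hu0]
        rw [integral_div, div_le_iff₀ hu0]
        refine hb.trans ?_
        rw [mul_assoc (√(2 * K * m)), show u ^ (-(1 / 2) : ℝ) * u = √u by
          rw [Real.sqrt_eq_rpow, ← Real.rpow_add_one hu0.ne']; norm_num,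
          ← Real.sqrt_mul (by nlinarith [sub_nonneg.2 hst'])]
        refine Real.sqrt_le_sqrt ?_
        have : u - s ≤ m := by linarith [hu.2]
        nlinarith [mul_le_mul_of_nonneg_left this (mul_nonneg hK0 hu0.le)]
    _ = _ := lintegral_Ioc_ofReal_mul_rpow s.2 hst' (Real.sqrt_nonneg _)

lemma quadVarFormula_zero (δ : ℝ) (X : ℝ≥0 → Ω → ℝ) (ω : Ω) : quadVarFormula δ X 0 ω = 0 := by
  simp [quadVarFormula]

/-- The triangle inequality in L¹ suffices, with no orthogonality between intervals: each error
carries √mesh times an increment of the square root, and these increments sum to √t. -/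
lemma IsMarkovProcessOf.eLpNorm_condSqSum_sub_le (hX : IsMarkovProcessOf G X ℱ μ)
    (hG : IsLogConvolutionSemigroup G) (hψ : laplaceExponent G (1 / 2) = 1)
    (hδ : δ = laplaceExponent G 1 / 2) (π : Subdivision t) :
    eLpNorm (π.condSqSum X μ - quadVarFormula δ X t) 1 μ ≤
      ENNReal.ofReal (2 * √(2 * (∫ z, (z ^ 2 - 1) ^ 2 ∂(gaussianReal 0 1)) * π.mesh)
        * √(t : ℝ)) := by
  set C := 2 * √(2 * (∫ z, (z ^ 2 - 1) ^ 2 ∂(gaussianReal 0 1)) * π.mesh) with hC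
  set D : Fin π.n → Ω → ℝ := fun k ω =>
    (μ[fun ω' => (X (π.pt k.succ) ω' - X (π.pt k.castSucc) ω') ^ 2 |
      MeasurableSpace.comap (X (π.pt k.castSucc)) inferInstance]) ω
      - (quadVarFormula δ X (π.pt k.succ) ω - quadVarFormula δ X (π.pt k.castSucc) ω) with hD
  have hlt : ∀ k : Fin π.n, π.pt k.castSucc < π.pt k.succ := fun k =>
    π.strictMono Fin.castSucc_lt_succ
  have hDm : ∀ k, AEStronglyMeasurable (D k) μ := fun k =>
    integrable_condExp.aestronglyMeasurable.sub
      ((hX.integrable_quadVarFormula δ _).aestronglyMeasurable.sub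
        (hX.integrable_quadVarFormula δ _).aestronglyMeasurable)
  have hsum : π.condSqSum X μ - quadVarFormula δ X t = ∑ k, D k := by
    ext ω
    rw [Finset.sum_apply, Pi.sub_apply]
    simp only [hD]
    rw [Finset.sum_sub_distrib, Fin.sum_succ_sub_castSucc fun k => quadVarFormula δ X (π.pt k) ω,
      π.first, π.last, quadVarFormula_zero, sub_zero]
    rfl
  rw [hsum]
  calc _ ≤ ∑ k, eLpNorm (D k) 1 μ := eLpNorm_sum_le (fun k _ => hDm k) le_rfl
    _ ≤ ∑ k : Fin π.n, ENNReal.ofReal (C * (√(π.pt k.succ : ℝ) - √(π.pt k.castSucc : ℝ))) := by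
        refine Finset.sum_le_sum fun k _ => ?_
        rw [eLpNorm_one_eq_lintegral_enorm]
        refine hX.lintegral_condExp_comap_sub_quadVarFormula_le hG hψ hδ (hlt k) ?_
        rw [← NNReal.coe_sub (hlt k).le]
        exact_mod_cast π.sub_le_mesh k
    _ = _ := by
        rw [← ENNReal.ofReal_sum_of_nonneg, ← Finset.mul_sum,
          Fin.sum_succ_sub_castSucc fun k => √(π.pt k : ℝ), π.first, π.last]
        · simp
        · intro k _
          have : √(π.pt k.castSucc : ℝ) ≤ √(π.pt k.succ : ℝ) :=
            Real.sqrt_le_sqrt (by exact_mod_cast (hlt k).le)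
          exact mul_nonneg (by positivity) (sub_nonneg.2 this)

lemma IsMarkovProcessOf.tendstoInMeasure_condSqSum (hX : IsMarkovProcessOf G X ℱ μ)
    (hG : IsLogConvolutionSemigroup G) (hψ : laplaceExponent G (1 / 2) = 1)
    (hδ : δ = laplaceExponent G 1 / 2) (π : ℕ → Subdivision t)
    (hπ : Tendsto (fun m => (π m).mesh) atTop (𝓝 0)) :
    TendstoInMeasure μ (fun m => (π m).condSqSum X μ) atTop (quadVarFormula δ X t) := by
  refine tendstoInMeasure_of_tendsto_eLpNorm one_ne_zero (fun m => ?_)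
    (hX.integrable_quadVarFormula δ t).aestronglyMeasurable
    (tendsto_of_tendsto_of_tendsto_of_le_of_le tendsto_const_nhds ?_ (fun _ => zero_le)
      fun m => hX.eLpNorm_condSqSum_sub_le hG hψ hδ (π m))
  · unfold Subdivision.condSqSum
    exact Finset.aestronglyMeasurable_fun_sum _ fun k _ => integrable_condExp.aestronglyMeasurable
  · have hc : Continuous fun x : ℝ≥0 => ENNReal.ofReal
        (2 * √(2 * (∫ z, (z ^ 2 - 1) ^ 2 ∂(gaussianReal 0 1)) * (x : ℝ)) * √(t : ℝ)) :=
      ENNReal.continuous_ofReal.comp (by fun_prop)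
    have h := hc.tendsto 0
    simp only [NNReal.coe_zero, mul_zero, Real.sqrt_zero, zero_mul, ENNReal.ofReal_zero] at h
    exact h.comp hπ

end ConditionalVariance

theorem mainTheorem3 {Ω : Type*} {mΩ : MeasurableSpace Ω} (μ : Measure Ω) [IsProbabilityMeasure μ]
    (ℱ : Filtration ℝ≥0 mΩ) (G : ℝ → Measure ℝ) (hG : IsLogConvolutionSemigroup G)
    (hψ : laplaceExponent G (1 / 2) = 1)
    (X : ℝ≥0 → Ω → ℝ) (hX : IsMarkovProcessOf G X ℱ μ)
    (δ : ℝ) (hδ : δ = laplaceExponent G 1 / 2) :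
    (∀ᵐ ω ∂μ, ∀ t : ℝ≥0,
      IntervalIntegrable (fun s : ℝ => X s.toNNReal ω ^ 2 / s) volume 0 t) ∧
    IsPredictableQuadraticVariation X (quadVarFormula δ X) ℱ μ ∧
    ∀ (t : ℝ≥0) (π : ℕ → Subdivision t),
      Tendsto (fun m => (π m).mesh) atTop (𝓝 0) →
      TendstoInMeasure μ (fun m => (π m).condSqSum X μ) atTop (quadVarFormula δ X t) := by
  have hδ0 : 0 ≤ δ := by linarith [laplaceExponent_one_nonneg hG hψ]
  have hδ1 : δ ≤ 1 := by linarith [laplaceExponent_one_le_two hG hψ]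
  refine ⟨hX.ae_intervalIntegrable, ?_,
    fun t π hπ => hX.tendstoInMeasure_condSqSum hG hψ hδ π hπ⟩
  exact
    { martingale := hX.martingale hG hψ
      memLp_two := fun t => hX.memLp t 2
      predictable := hX.isProgressive.isStronglyPredictable_quadVarFormula δ
      zero := ae_of_all _ fun ω => quadVarFormula_zero δ X ω
      monotone := hX.ae_sqDivLIntegral_ne_top.mono fun ω hω =>
        monotone_quadVarFormula hδ0 hδ1 hX.isProgressive hω
      rightContinuous := hX.ae_sqDivLIntegral_ne_top.mono fun ω hω t =>
        (continuous_quadVarFormula δ hX.isProgressive hω).continuousWithinAt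
      sq_sub_martingale := hX.martingale_sq_sub_quadVarFormula hG hψ hδ }
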